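/- Let $\Gamma$ be a finite bipartite distance-regular graph with vertex set $X$, path-length distance $\partial$, diameter $D\ge 4$ and valency $k\ge 3$. For $0\le h,i,j\le D$ let $p^h_{ij}$ be its intersection numbers: $p^h_{ij}=|\{z : \partial(y,z)=i,\ \partial(z,w)=j\}|$ whenever $\partial(y,w)=h$. Put $c_i=p^i_{1,i-1}$ $(1\le i\le D)$, $b_i=p^i_{1,i+1}$ $(0\le i\le D-1)$, $c_0=b_D=0$, $k_i=p^0_{ii}$. Let $A_i$ be the $i$-th distance matrix, $A=A_1$, let $\theta_0>\theta_1>\cdots>\theta_D$ be the distinct eigenvalues of $A$, and let $E_j$ be the primitive idempotent of $A$ associated with $\theta_j$ (the orthogonal projection of $V=\mathbb C^X$ onto the $\theta_j$-eigenspace of $A$). Put $d=\lfloor D/2\rfloor$ and $$\tilde\theta_n=-1-\frac{b_2b_3}{\theta_n^2-b_2}\qquad (n\in\{1,d\}).$$ Define polynomials $f_i,p_i\in\mathbb R[\lambda]$ $(0\le i\le D)$ by $f_{-1}=0$, $f_0=1$, $\lambda f_i=b_{i-1}f_{i-1}+c_{i+1}f_{i+1}$ $(0\le i\le D-1)$ and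 $p_i=\sum_{0\le h\le i,\ i-h\text{ even}}f_h$. Let $P_i\in\mathbb R[\lambda]$ be the polynomial with $p_i(\lambda)=P_i(\lambda^2)$ if $i$ is even and $p_i(\lambda)=\lambda P_i(\lambda^2)$ if $i$ is odd. Fix $x\in X$. Let $E^*_i$ be the diagonal matrix whose $(y,y)$-entry is $1$ if $\partial(x,y)=i$ and $0$ otherwise, and let $T=T(x)$ be the subalgebra of $\mathrm{Mat}_X(\mathbb C)$ generated by $A,E^*_0,\dots,E^*_D$. A $T$-module is a $T$-invariant subspace of $V$. Let $W$ be an irreducible $T$-module that is thin ($\dim E^*_iW\le 1$ for $0\le i\le D$) with endpoint $2$ ($\min\{i: E^*_iW\ne 0\}=2$), and let $\eta\in\mathbb R$ be its local eigenvalue, i.e. the eigenvalue of $E^*_2A_2E^*_2$ on the one-dimensional space $E^*_2W$. Assume $\tilde\theta_1<\eta<\tilde\theta_d$, and let $v$ be a nonzero vector in $E^*_2W$. Then the vectors $E_jv$ $(1\le j\le D-1)$ form a basis of $W$, the vectors $E^*_{i+2}A_iv$ $(0\le i\le D-2)$ form a basis of $W$, and these two bases are related as follows. (i) Suppose $\eta\ne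 -1$, and put $\psi=b_2\left(1-\frac{b_3}{1+\eta}\right)$. Then $P_i(\psi)\neq 0$ for $0\le i\le D-2$, and $$E^*_{i+2}A_iv=\sum_{j=1}^{D-1}g_i(\theta_j)\,E_jv\quad(0\le i\le D-2),\qquad g_i=\sum_{\substack{0\le h\le i\\ i-h\text{ even}}}\frac{P_h(\psi)}{P_i(\psi)}\,\frac{k_ib_ib_{i+1}}{k_hb_hb_{h+1}}\,p_h .$$ (ii) Suppose $\eta=-1$. Then $$E^*_{i+2}A_iv=\sum_{j=1}^{D-1}p_i(\theta_j)\,E_jv\qquad(0\le i\le D-2).$$ -/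

import Mathlib

open scoped Matrix

namespace BipartiteDRG

open Polynomial

noncomputable section

/-! ### Distance-regular graphs -/

/-- The number of vertices `z` with `∂(x, z) = i` and `∂(z, y) = j`. -/
def distCount {X : Type*} [Fintype X] (Γ : SimpleGraph X) (x y : X) (i j : ℕ) : ℕ :=
  (Finset.univ.filter fun z => Γ.dist x z = i ∧ Γ.dist z y = j).card

/-- `Γ` is distance-regular: it is connected, and the number of `z` with `∂(x, z) = i`,
`∂(z, y) = j` depends only on `i`, `j` and `∂(x, y)`. -/
def IsDistanceRegular {X : Type*} [Fintype X] (Γ : SimpleGraph X) : Prop :=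
  Γ.Connected ∧ ∀ (i j : ℕ) (x y x' y' : X), Γ.dist x y = Γ.dist x' y' →
    distCount Γ x y i j = distCount Γ x' y' i j

/-- The intersection number `p^h_{ij}`: the common value of `distCount Γ x y i j` over all `x, y`
with `∂(x, y) = h`, written as a maximum over these pairs (it is `0` if there are none). -/
def intersectionNumber {X : Type*} [Fintype X] (Γ : SimpleGraph X) (h i j : ℕ) : ℕ :=
  (Finset.univ.filter fun q : X × X => Γ.dist q.1 q.2 = h).sup fun q => distCount Γ q.1 q.2 i j

theorem intersectionNumber_eq {X : Type*} [Fintype X] {Γ : SimpleGraph X}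
    (hΓ : IsDistanceRegular Γ) (i j : ℕ) (x y : X) :
    intersectionNumber Γ (Γ.dist x y) i j = distCount Γ x y i j := by
  refine le_antisymm (Finset.sup_le fun q hq => ?_) ?_
  · exact (hΓ.2 i j _ _ _ _ (Finset.mem_filter.1 hq).2).le
  · exact Finset.le_sup (f := fun q : X × X => distCount Γ q.1 q.2 i j)
      (b := (x, y)) (by simp)

/-- The intersection number `c_i = p^i_{1, i-1}`, as a real number; `c_0 = 0`. -/
def c {X : Type*} [Fintype X] (Γ : SimpleGraph X) (i : ℕ) : ℝ :=
  if i = 0 then 0 else (intersectionNumber Γ i 1 (i - 1) : ℝ)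

/-- The intersection number `b_i = p^i_{1, i+1}`, as a real number. No vertex is at distance
`D + 1` from another one, so that `b_D = 0`. -/
def b {X : Type*} [Fintype X] (Γ : SimpleGraph X) (i : ℕ) : ℝ :=
  (intersectionNumber Γ i 1 (i + 1) : ℝ)

/-- The number `k_i = p^0_{ii}` of vertices at distance `i` from a vertex, as a real number. -/
def kk {X : Type*} [Fintype X] (Γ : SimpleGraph X) (i : ℕ) : ℝ :=
  (intersectionNumber Γ 0 i i : ℝ)

/-! ### Distance matrices, eigenvalues, primitive idempotents -/

/-- The `i`-th distance matrix `A_i`. -/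
def distMatrix {X : Type*} (Γ : SimpleGraph X) (i : ℕ) : Matrix X X ℂ :=
  Matrix.of fun y z => if Γ.dist y z = i then 1 else 0

/-- The adjacency matrix `A = A_1`. -/
def A {X : Type*} (Γ : SimpleGraph X) : Matrix X X ℂ := distMatrix Γ 1

theorem A_isHermitian {X : Type*} (Γ : SimpleGraph X) : (A Γ).IsHermitian := by
  ext y z
  simp only [A, distMatrix, Matrix.conjTranspose_apply, Matrix.of_apply, Γ.dist_comm (u := z)]
  split_ifs <;> simp

/-- The set of distinct (real) eigenvalues of `A`. -/
def eigenvalueSet {X : Type*} [Fintype X] [DecidableEq X] (Γ : SimpleGraph X) : Finset ℝ :=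
  Finset.univ.image (A_isHermitian Γ).eigenvalues

theorem mem_eigenvalueSet_iff {X : Type*} [Fintype X] [DecidableEq X] (Γ : SimpleGraph X)
    (t : ℝ) :
    t ∈ eigenvalueSet Γ ↔ Module.End.HasEigenvalue (Matrix.toLin' (A Γ)) (t : ℂ) := by
  have h : t ∈ eigenvalueSet Γ ↔ t ∈ spectrum ℝ (A Γ) := by
    rw [(A_isHermitian Γ).spectrum_real_eq_range_eigenvalues]
    simp [eigenvalueSet]
  rw [h, Module.End.hasEigenvalue_iff_mem_spectrum, Matrix.spectrum_toLin',
    ← spectrum.algebraMap_mem_iff ℂ]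
  rfl

/-- The eigenvalue `θ_i`: the distinct eigenvalues of `A` are `θ_0 > θ_1 > ⋯ > θ_D`. -/
def theta {X : Type*} [Fintype X] [DecidableEq X] (Γ : SimpleGraph X) (i : ℕ) : ℝ :=
  ((eigenvalueSet Γ).sort (· ≥ ·)).getD i 0

/-- `primIdem Γ t` is the primitive idempotent of `A` for its eigenvalue `t`, that is,
`∏_{s ≠ t} (A - s) / (t - s)`, where `s` runs over the other eigenvalues of `A`. -/
def primIdem {X : Type*} [Fintype X] [DecidableEq X] (Γ : SimpleGraph X) (t : ℝ) :
    Matrix X X ℂ :=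
  aeval (A Γ) (Lagrange.basis (eigenvalueSet Γ) id t)

/-- The primitive idempotent `E_i` of `A` associated with `θ_i`. -/
def E {X : Type*} [Fintype X] [DecidableEq X] (Γ : SimpleGraph X) (i : ℕ) : Matrix X X ℂ :=
  primIdem Γ (theta Γ i)

/-! ### Polynomials -/

/-- The polynomials `f_i`: `f_0 = 1` and `λ f_i = b_{i-1} f_{i-1} + c_{i+1} f_{i+1}`,
where `f_{-1} = 0`. -/
def fPoly {X : Type*} [Fintype X] (Γ : SimpleGraph X) : ℕ → ℝ[X]
  | 0 => 1
  | 1 => C (c Γ 1)⁻¹ * Polynomial.X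
  | i + 2 => C (c Γ (i + 2))⁻¹ * (Polynomial.X * fPoly Γ (i + 1) - C (b Γ i) * fPoly Γ i)

/-- The polynomials `p_i = f_i + f_{i-2} + f_{i-4} + ⋯`, ending in `f_0` or `f_1`. -/
def pPoly {X : Type*} [Fintype X] (Γ : SimpleGraph X) (i : ℕ) : ℝ[X] :=
  ∑ h ∈ (Finset.range (i + 1)).filter (fun h => Even (i - h)), fPoly Γ h

/-- The polynomials `P_i` with `p_i(λ) = P_i(λ²)` for even `i` and `p_i(λ) = λ P_i(λ²)`
for odd `i`. -/
def PPoly {X : Type*} [Fintype X] (Γ : SimpleGraph X) (i : ℕ) : ℝ[X] :=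
  if Even i then contract 2 (pPoly Γ i) else contract 2 (divX (pPoly Γ i))

theorem fPoly_coeff_eq_zero {X : Type*} [Fintype X] (Γ : SimpleGraph X) (i n : ℕ)
    (h : ¬ Even (i + n)) : (fPoly Γ i).coeff n = 0 := by
  induction i using Nat.strong_induction_on generalizing n with
  | _ i ih =>
    match i with
    | 0 =>
      rw [fPoly, coeff_one, if_neg]
      rintro rfl
      simp at h
    | 1 =>
      rw [fPoly, coeff_C_mul, coeff_X, if_neg, mul_zero]
      rintro rfl
      exact h ⟨1, rfl⟩
    | i + 2 =>
      rw [fPoly, coeff_C_mul, coeff_sub, coeff_C_mul, ih i (by omega) n (by grind)]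
      cases n with
      | zero => simp
      | succ n => rw [coeff_X_mul, ih (i + 1) (by omega) n (by grind)]; simp

theorem pPoly_coeff_eq_zero {X : Type*} [Fintype X] (Γ : SimpleGraph X) (i n : ℕ)
    (h : ¬ Even (i + n)) : (pPoly Γ i).coeff n = 0 := by
  rw [pPoly, finsetSum_coeff]
  refine Finset.sum_eq_zero fun j hj => fPoly_coeff_eq_zero Γ j n ?_
  rw [Finset.mem_filter, Finset.mem_range] at hj
  grind

theorem pPoly_eq_of_even {X : Type*} [Fintype X] (Γ : SimpleGraph X) (i : ℕ) (hi : Even i) :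
    pPoly Γ i = (PPoly Γ i).comp (Polynomial.X ^ 2) := by
  rw [PPoly, if_pos hi, ← expand_eq_comp_X_pow]
  ext n
  rw [coeff_expand two_pos]
  split_ifs with hn
  · rw [coeff_contract two_ne_zero, Nat.div_mul_cancel hn]
  · exact pPoly_coeff_eq_zero Γ i n (by grind)

theorem pPoly_eq_of_odd {X : Type*} [Fintype X] (Γ : SimpleGraph X) (i : ℕ) (hi : ¬ Even i) :
    pPoly Γ i = Polynomial.X * (PPoly Γ i).comp (Polynomial.X ^ 2) := by
  rw [PPoly, if_neg hi, ← expand_eq_comp_X_pow]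
  ext n
  cases n with
  | zero => rw [coeff_X_mul_zero, pPoly_coeff_eq_zero Γ i 0 (by simpa using hi)]
  | succ n =>
    rw [coeff_X_mul, coeff_expand two_pos]
    split_ifs with hn
    · rw [coeff_contract two_ne_zero, Nat.div_mul_cancel hn, coeff_divX]
    · exact pPoly_coeff_eq_zero Γ i (n + 1) (by grind)

/-- The polynomials `g_i`, for the parameter `ψ`:
`g_i = ∑ (P_h(ψ) / P_i(ψ)) (k_i b_i b_{i+1} / (k_h b_h b_{h+1})) p_h`,
the sum over all `0 ≤ h ≤ i` with `i - h` even. -/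
def gPoly {X : Type*} [Fintype X] (Γ : SimpleGraph X) (ψ : ℝ) (i : ℕ) : ℝ[X] :=
  ∑ h ∈ (Finset.range (i + 1)).filter (fun h => Even (i - h)),
    C ((PPoly Γ h).eval ψ / (PPoly Γ i).eval ψ *
      (kk Γ i * b Γ i * b Γ (i + 1) / (kk Γ h * b Γ h * b Γ (h + 1)))) * pPoly Γ h

/-! ### The subconstituent algebra and its modules -/

/-- The dual idempotent `E*_i = E*_i(x)`. -/
def Estar {X : Type*} [DecidableEq X] (Γ : SimpleGraph X) (x : X) (i : ℕ) : Matrix X X ℂ :=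
  Matrix.diagonal fun y => if Γ.dist x y = i then 1 else 0

/-- The subconstituent algebra `T = T(x)`, generated by `A` and all `E*_i`
(`E*_i = 0` for `i > D`). -/
def T {X : Type*} [Fintype X] [DecidableEq X] (Γ : SimpleGraph X) (x : X) :
    Subalgebra ℂ (Matrix X X ℂ) :=
  Algebra.adjoin ℂ (insert (A Γ) (Set.range (Estar Γ x)))

/-- A `T`-module: a subspace `W` of `V = ℂ^X` with `B W ⊆ W` for all `B ∈ T`. -/
def IsTModule {X : Type*} [Fintype X] [DecidableEq X] (Γ : SimpleGraph X) (x : X)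
    (W : Submodule ℂ (X → ℂ)) : Prop :=
  ∀ B ∈ T Γ x, ∀ w ∈ W, B *ᵥ w ∈ W

/-- An irreducible `T`-module. -/
def IsIrreducibleTModule {X : Type*} [Fintype X] [DecidableEq X] (Γ : SimpleGraph X) (x : X)
    (W : Submodule ℂ (X → ℂ)) : Prop :=
  IsTModule Γ x W ∧ W ≠ ⊥ ∧
    ∀ W' : Submodule ℂ (X → ℂ), IsTModule Γ x W' → W' ≤ W → W' = ⊥ ∨ W' = W

/-- The space `E*_i W`. -/
def EstarSpace {X : Type*} [Fintype X] [DecidableEq X] (Γ : SimpleGraph X) (x : X) (i : ℕ)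
    (W : Submodule ℂ (X → ℂ)) : Submodule ℂ (X → ℂ) :=
  W.map (Matrix.toLin' (Estar Γ x i))

/-- `W` is thin: `dim E*_i W ≤ 1` for all `i`. -/
def IsThin {X : Type*} [Fintype X] [DecidableEq X] (Γ : SimpleGraph X) (x : X)
    (W : Submodule ℂ (X → ℂ)) : Prop :=
  ∀ i ≤ Γ.diam, Module.finrank ℂ (EstarSpace Γ x i W) ≤ 1

/-- `W` has endpoint `r`: `r` is the least `i ∈ {0, …, D}` with `E*_i W ≠ 0`. -/
def HasEndpoint {X : Type*} [Fintype X] [DecidableEq X] (Γ : SimpleGraph X) (x : X)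
    (W : Submodule ℂ (X → ℂ)) (r : ℕ) : Prop :=
  IsLeast {i | i ≤ Γ.diam ∧ EstarSpace Γ x i W ≠ ⊥} r

/-- `η` is the local eigenvalue of `W` (thin, irreducible, of endpoint two): the
one-dimensional space `E*_2 W` consists of eigenvectors of `E*_2 A_2 E*_2` for `η`. -/
def HasLocalEigenvalue {X : Type*} [Fintype X] [DecidableEq X] (Γ : SimpleGraph X) (x : X)
    (W : Submodule ℂ (X → ℂ)) (η : ℝ) : Prop :=
  EstarSpace Γ x 2 W ≠ ⊥ ∧ ∀ w ∈ EstarSpace Γ x 2 W,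
    (Estar Γ x 2 * distMatrix Γ 2 * Estar Γ x 2) *ᵥ w = (η : ℂ) • w

/-- `z̃ = -1 - b_2 b_3 / (z² - b_2)`, for real `z` with `z² ≠ b_2`. -/
def tilde {X : Type*} [Fintype X] (Γ : SimpleGraph X) (z : ℝ) : ℝ :=
  -1 - b Γ 2 * b Γ 3 / (z ^ 2 - b Γ 2)

/-- `ψ = b_2 (1 - b_3 / (1 + η))`, for `η ≠ -1`. -/
def psi {X : Type*} [Fintype X] (Γ : SimpleGraph X) (η : ℝ) : ℝ :=
  b Γ 2 * (1 - b Γ 3 / (1 + η))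

/-- The finite family `u` is a basis of the subspace `W`. -/
def IsBasisOf {X ι : Type*} (W : Submodule ℂ (X → ℂ)) (u : ι → X → ℂ) : Prop :=
  LinearIndependent ℂ u ∧ Submodule.span ℂ (Set.range u) = W

/-! ### The primitive idempotents are the spectral projections of `A` -/

theorem sum_primIdem {X : Type*} [Fintype X] [DecidableEq X] [Nonempty X]
    (Γ : SimpleGraph X) : ∑ t ∈ eigenvalueSet Γ, primIdem Γ t = 1 := by
  simp only [primIdem]
  rw [← map_sum, Lagrange.sum_basis Function.injective_id.injOn, map_one]
  exact Finset.univ_nonempty.image _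

theorem aeval_nodal_eigenvalueSet {X : Type*} [Fintype X] [DecidableEq X]
    (Γ : SimpleGraph X) : aeval (A Γ) (Lagrange.nodal (eigenvalueSet Γ) id) = 0 := by
  have key : ∀ (q : ℝ[X]) (j : X), aeval (A Γ) q *ᵥ ⇑((A_isHermitian Γ).eigenvectorBasis j) =
      (q.eval ((A_isHermitian Γ).eigenvalues j)) • ⇑((A_isHermitian Γ).eigenvectorBasis j) := by
    intro q j
    induction q using Polynomial.induction_on' with
    | add p q hp hq => rw [map_add, Matrix.add_mulVec, hp, hq, eval_add, add_smul]
    | monomial n a =>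
      rw [aeval_monomial, eval_monomial, Algebra.algebraMap_eq_smul_one, smul_mul_assoc, one_mul,
        Matrix.smul_mulVec, mul_smul]
      congr 1
      induction n with
      | zero => simp
      | succ n ih =>
        rw [pow_succ, ← Matrix.mulVec_mulVec, (A_isHermitian Γ).mulVec_eigenvectorBasis,
          Matrix.mulVec_smul, ih, smul_smul, pow_succ, mul_comm]
  have hz : ∀ j : X, aeval (A Γ) (Lagrange.nodal (eigenvalueSet Γ) id) *ᵥ
      ⇑((A_isHermitian Γ).eigenvectorBasis j) = 0 := by
    intro j
    rw [key]
    have : (Lagrange.nodal (eigenvalueSet Γ) id).eval ((A_isHermitian Γ).eigenvalues j) = 0 :=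
      Lagrange.eval_nodal_at_node (v := id)
        (Finset.mem_image_of_mem _ (Finset.mem_univ j))
    rw [this, zero_smul]
  generalize aeval (A Γ) (Lagrange.nodal (eigenvalueSet Γ) id) = B at hz
  have h0 : Matrix.toEuclideanLin B = 0 := by
    refine (A_isHermitian Γ).eigenvectorBasis.toBasis.ext fun j => ?_
    ext y
    simpa using congrFun (hz j) y
  simpa using h0

theorem A_mul_primIdem {X : Type*} [Fintype X] [DecidableEq X] (Γ : SimpleGraph X) (t : ℝ)
    (ht : t ∈ eigenvalueSet Γ) : A Γ * primIdem Γ t = t • primIdem Γ t := by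
  have h : (Polynomial.X - C t) * Lagrange.basis (eigenvalueSet Γ) id t =
      C (Lagrange.nodalWeight (eigenvalueSet Γ) id t) *
        Lagrange.nodal (eigenvalueSet Γ) id := by
    rw [Lagrange.basis_eq_prod_sub_inv_mul_nodal_div ht, ← Lagrange.nodal_erase_eq_nodal_div ht,
      Lagrange.nodal_eq_mul_nodal_erase ht]
    simp only [id]
    ring
  have h2 := congrArg (aeval (A Γ)) h
  rw [map_mul, map_mul, aeval_nodal_eigenvalueSet, mul_zero, map_sub, aeval_X, aeval_C, sub_mul,
    sub_eq_zero] at h2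
  rw [primIdem, h2, Algebra.algebraMap_eq_smul_one, smul_mul_assoc, one_mul]

end

end BipartiteDRG

open BipartiteDRG

/-! Write w_i = E*_{i+2} A_i v. Two facts carry the proof: no nonzero polynomial of degree below D -
1 in A kills v, and p_i(A) v = w_i + E*_i p_i(A) v.

For the first, two vertices at distance 2 from x are at distance 0, 2 or 4. The entries of v sum to
zero because W has no component at x. Hence E*_2 A_4 v = -(1 + η) v, and E*_2 F v is an explicit
multiple of v for every F = ∑ a_h A_h. Taking F to be the idempotent of an eigenvalue t gives
(`IsLocalEigenvector.normSq_primIdem`) that ‖E v‖² is a positive multiple of (b_0² - t²) L(t²) ‖v‖²,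
where L(s) = (1 + η)(s - b_2) + b_2 b_3. So E_0 v = E_D v = 0. For the other eigenvalues L(θ_j²) ≥
0. As L is affine and does not vanish at the extreme squares θ_1² and θ_d², it vanishes at none
between them, so E_j v ≠ 0 for 1 ≤ j ≤ D - 1. When η ≠ -1, the root of L is ψ.

The second fact (`aeval_pPoly_mulVec`) is a count of distances. By thinness its last term is a
multiple of w_{i-2}, once w_{i-2} ≠ 0. Inductively w_i is a polynomial of degree i in A applied to
v, hence nonzero for i ≤ D - 2 by the first fact. The w_i lie in distinct layers and exhaust W, so
dim W = D - 1. The E_j v are D - 1 eigenvectors for distinct eigenvalues, hence also a basis.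

For the transition, put p_{i+2}(A) v = w_{i+2} + e_i w_i and A w_{i+1} = c_{i+2} w_{i+2} + β_i w_i.
Comparing components in λ p_{i+1} = c_{i+2} p_{i+2} + b_{i+2} p_i yields recurrences for e_i and β_i
with e_0 = 1 + η and β_i ≠ 0 (`exists_raise_coefficients`). If η = -1, all e_i needed vanish and w_i
= p_i(A) v. Otherwise `recurrence_solution` gives e_i c_{i+1} c_{i+2} P_{i+2}(ψ) = -b_{i+2} b_{i+3}
P_i(ψ), with the nonvanishing of P_i(ψ) forced by β_i ≠ 0. Then w_{i+2} = p_{i+2}(A) v - e_i w_i is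
the recurrence that defines g_i. -/

namespace BipartiteDRG
open Polynomial

/-! ### Distances and parity in a connected bipartite graph -/

section Metric

variable {X : Type*} {Γ : SimpleGraph X}

/-- The parity of a distance records whether a 2-colouring separates the two vertices, and around a
triangle the colour changes an even number of times. -/
theorem even_dist_add_dist (hc : Γ.Connected) (hbip : Γ.IsBipartite) (x y z : X) :
    Even (Γ.dist x y + Γ.dist y z + Γ.dist x z) := by
  obtain ⟨C⟩ := hbip
  let C' : Γ.Coloring Bool := SimpleGraph.Coloring.mk (fun u => C u = 0) (by
    intro u w h h'
    have := C.valid h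
    simp only [decide_eq_decide] at h'
    apply this
    generalize C u = p at *
    generalize C w = q at *
    fin_cases p <;> fin_cases q <;> simp_all)
  have key : ∀ u w : X, Even (Γ.dist u w) ↔ (C' u ↔ C' w) := by
    intro u w
    obtain ⟨p, hp⟩ := hc.exists_walk_length_eq_dist u w
    rw [← hp]
    exact C'.even_length_iff_congr p
  have h1 := key x y
  have h2 := key y z
  have h3 := key x z
  rw [Nat.even_add, Nat.even_add, h1, h2, h3]
  tauto

theorem dist_of_adj (hc : Γ.Connected) (hbip : Γ.IsBipartite) {y z : X} (h : Γ.dist y z = 1)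
    (w : X) : Γ.dist z w = Γ.dist y w + 1 ∨ Γ.dist z w + 1 = Γ.dist y w := by
  have h1 := even_dist_add_dist hc hbip y z w
  have h2 := hc.dist_triangle (u := y) (v := z) (w := w)
  have h3 := hc.dist_triangle (u := z) (v := y) (w := w)
  rw [Γ.dist_comm (u := z) (v := y)] at h3
  rw [h] at h1 h2 h3
  grind

theorem exists_adj_dist_add_one (hc : Γ.Connected) {y w : X} {h : ℕ} (hd : Γ.dist y w = h + 1) :
    ∃ z, Γ.dist y z = 1 ∧ Γ.dist z w = h := by
  obtain ⟨p, hp⟩ := hc.exists_walk_length_eq_dist y w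
  cases p with
  | nil => rw [SimpleGraph.dist_self] at hd; omega
  | @cons _ z _ hadj q =>
    refine ⟨z, SimpleGraph.dist_eq_one_iff_adj.2 hadj, ?_⟩
    have h1 := SimpleGraph.dist_le q
    have h2 := hc.dist_triangle (u := y) (v := z) (w := w)
    rw [SimpleGraph.dist_eq_one_iff_adj.2 hadj] at h2
    simp only [SimpleGraph.Walk.length_cons] at hp
    omega

theorem dist_le_diam_of_connected [Finite X] (hc : Γ.Connected) (y z : X) : Γ.dist y z ≤ Γ.diam := by
  have := hc.nonempty
  exact SimpleGraph.dist_le_diam (SimpleGraph.connected_iff_ediam_ne_top.1 hc)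

theorem exists_dist_eq [Finite X] (hc : Γ.Connected) {i : ℕ} (hi : i ≤ Γ.diam) :
    ∃ y z : X, Γ.dist y z = i := by
  have := hc.nonempty
  induction hi using Nat.decreasingInduction with
  | self => exact SimpleGraph.exists_dist_eq_diam
  | of_succ k hk ih =>
    obtain ⟨y, w, h⟩ := ih
    obtain ⟨z, -, hz⟩ := exists_adj_dist_add_one hc h
    exact ⟨z, w, hz⟩

end Metric

/-! ### Intersection numbers -/

section Counting

variable {X : Type*} [Fintype X] {Γ : SimpleGraph X}

theorem b_eq_card (hΓ : IsDistanceRegular Γ) (y w : X) :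
    b Γ (Γ.dist y w) =
      ((Finset.univ.filter fun z => Γ.dist y z = 1 ∧ Γ.dist z w = Γ.dist y w + 1).card : ℝ) := by
  rw [b, intersectionNumber_eq hΓ]; rfl

theorem c_succ_eq_card (hΓ : IsDistanceRegular Γ) {y w : X} {h : ℕ} (hd : Γ.dist y w = h + 1) :
    c Γ (h + 1) = ((Finset.univ.filter fun z => Γ.dist y z = 1 ∧ Γ.dist z w = h).card : ℝ) := by
  rw [c, if_neg (by omega), ← hd, intersectionNumber_eq hΓ, hd]; rfl

theorem kk_eq_card (hΓ : IsDistanceRegular Γ) (y : X) (i : ℕ) :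
    kk Γ i = ((Finset.univ.filter fun z => Γ.dist y z = i).card : ℝ) := by
  rw [kk, ← SimpleGraph.dist_self (G := Γ) (v := y), intersectionNumber_eq hΓ, distCount]
  congr 3
  ext z
  rw [Γ.dist_comm (u := z)]
  simp

/-- The sum over the neighbours of `y` of a function of the distance to `w`. -/
theorem sum_adj (hΓ : IsDistanceRegular Γ) (hbip : Γ.IsBipartite) (a : ℕ → ℝ) (y w : X) :
    ∑ z, (if Γ.dist y z = 1 then a (Γ.dist z w) else 0) =
      c Γ (Γ.dist y w) * a (Γ.dist y w - 1) + b Γ (Γ.dist y w) * a (Γ.dist y w + 1) := by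
  have hsplit : ∀ z, (if Γ.dist y z = 1 then a (Γ.dist z w) else 0) =
      (if Γ.dist y z = 1 ∧ Γ.dist z w + 1 = Γ.dist y w then a (Γ.dist y w - 1) else 0) +
      (if Γ.dist y z = 1 ∧ Γ.dist z w = Γ.dist y w + 1 then a (Γ.dist y w + 1) else 0) := by
    intro z
    by_cases hz : Γ.dist y z = 1
    · rcases dist_of_adj hΓ.1 hbip hz w with h | h
      · rw [if_pos hz, if_neg (by omega), if_pos ⟨hz, h⟩, h, zero_add]
      · rw [if_pos hz, if_pos ⟨hz, h⟩, if_neg (by omega), ← h, add_zero, Nat.add_sub_cancel]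
    · simp [hz]
  rw [Finset.sum_congr rfl fun z _ => hsplit z, Finset.sum_add_distrib]
  congr 1
  · rw [← Finset.sum_filter, Finset.sum_const, nsmul_eq_mul]
    rcases hd : Γ.dist y w with _ | h
    · simp [c]
    · simp only [c_succ_eq_card hΓ hd, Nat.add_right_cancel_iff, Nat.add_sub_cancel]
  · rw [← Finset.sum_filter, Finset.sum_const, nsmul_eq_mul, b_eq_card hΓ]

theorem c_zero : c Γ 0 = 0 := if_pos rfl

theorem sum_adj_one (hΓ : IsDistanceRegular Γ) (hbip : Γ.IsBipartite) (y : X) :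
    ∑ z, (if Γ.dist y z = 1 then (1 : ℝ) else 0) = b Γ 0 := by
  have := sum_adj hΓ hbip (fun _ => 1) y y
  simpa [c_zero] using this

theorem c_add_b (hΓ : IsDistanceRegular Γ) (hbip : Γ.IsBipartite) {i : ℕ} (hi : i ≤ Γ.diam) :
    c Γ i + b Γ i = b Γ 0 := by
  obtain ⟨y, w, rfl⟩ := exists_dist_eq hΓ.1 hi
  rw [← sum_adj_one hΓ hbip y, sum_adj hΓ hbip (fun _ => 1) y w]
  ring

theorem c_pos (hΓ : IsDistanceRegular Γ) {i : ℕ} (h0 : 1 ≤ i) (hi : i ≤ Γ.diam) : 0 < c Γ i := by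
  obtain ⟨i, rfl⟩ := Nat.exists_eq_add_of_le' h0
  obtain ⟨y, w, h⟩ := exists_dist_eq hΓ.1 hi
  rw [c_succ_eq_card hΓ h]
  obtain ⟨z, hz⟩ := exists_adj_dist_add_one hΓ.1 h
  exact_mod_cast Finset.card_pos.2 ⟨z, by simpa using hz⟩

theorem b_pos (hΓ : IsDistanceRegular Γ) {i : ℕ} (hi : i < Γ.diam) : 0 < b Γ i := by
  obtain ⟨y, w, h⟩ := exists_dist_eq hΓ.1 (Nat.succ_le_of_lt hi)
  obtain ⟨z, hz, rfl⟩ := exists_adj_dist_add_one hΓ.1 h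
  rw [b_eq_card hΓ]
  exact_mod_cast Finset.card_pos.2 ⟨y, by
    rw [Finset.mem_filter, Γ.dist_comm (u := z)]; exact ⟨Finset.mem_univ _, hz, h⟩⟩

theorem b_diam (hΓ : IsDistanceRegular Γ) : b Γ Γ.diam = 0 := by
  obtain ⟨y, w, h⟩ := exists_dist_eq hΓ.1 le_rfl
  have := b_eq_card hΓ y w
  rw [h] at this
  rw [this, Nat.cast_eq_zero, Finset.card_eq_zero, Finset.filter_eq_empty_iff]
  rintro z - ⟨-, hz⟩
  have := dist_le_diam_of_connected hΓ.1 z w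
  omega

theorem c_one (hΓ : IsDistanceRegular Γ) (hi : 1 ≤ Γ.diam) : c Γ 1 = 1 := by
  obtain ⟨y, w, h⟩ := exists_dist_eq hΓ.1 hi
  rw [c_succ_eq_card hΓ h]
  norm_cast
  rw [Finset.card_eq_one]
  refine ⟨w, Finset.ext fun z => ?_⟩
  simp only [Finset.mem_filter, Finset.mem_univ, true_and, Finset.mem_singleton,
    hΓ.1.dist_eq_zero_iff]
  exact ⟨fun h => h.2, fun hz => ⟨hz ▸ h, hz⟩⟩

theorem kk_zero (hΓ : IsDistanceRegular Γ) : kk Γ 0 = 1 := by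
  obtain ⟨y⟩ := hΓ.1.nonempty
  rw [kk_eq_card hΓ y]
  norm_cast
  rw [Finset.card_eq_one]
  refine ⟨y, Finset.ext fun z => ?_⟩
  simp [hΓ.1.dist_eq_zero_iff, eq_comm]

/-- Count adjacent pairs (y, z) with z at distance i + 1 from a base vertex in two ways: by z, which
has b_0 neighbours, and by y, which lies at distance i or i + 2. -/
theorem kk_mul_b_zero (hΓ : IsDistanceRegular Γ) (hbip : Γ.IsBipartite) (i : ℕ) :
    kk Γ (i + 1) * b Γ 0 = b Γ i * kk Γ i + c Γ (i + 2) * kk Γ (i + 2) := by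
  obtain ⟨x⟩ := hΓ.1.nonempty
  have h1 : ∀ y, c Γ (Γ.dist y x) * (if Γ.dist y x - 1 = i + 1 then 1 else 0) +
      b Γ (Γ.dist y x) * (if Γ.dist y x + 1 = i + 1 then 1 else 0) =
      b Γ i * (if Γ.dist x y = i then 1 else 0) +
        c Γ (i + 2) * (if Γ.dist x y = i + 2 then 1 else 0) := by
    intro y
    rw [Γ.dist_comm (u := y)]
    generalize Γ.dist x y = d
    by_cases h : d = i
    · subst h; simp
    · by_cases h' : d = i + 2
      · subst h'; simp
      · rw [if_neg (by omega), if_neg (by omega), if_neg (by omega), if_neg (by omega)]; ring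
  have h2 := Finset.sum_congr (s₁ := Finset.univ) rfl fun y _ =>
    sum_adj hΓ hbip (fun h => if h = i + 1 then (1 : ℝ) else 0) y x
  rw [Finset.sum_comm, Finset.sum_congr rfl fun y _ => h1 y, Finset.sum_add_distrib,
    ← Finset.mul_sum, ← Finset.mul_sum] at h2
  have h3 : ∀ z, ∑ y, (if Γ.dist y z = 1 then if Γ.dist z x = i + 1 then (1 : ℝ) else 0 else 0) =
      if Γ.dist x z = i + 1 then b Γ 0 else 0 := by
    intro z
    rw [← sum_adj_one hΓ hbip z, Γ.dist_comm (u := x)]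
    split_ifs with h
    · exact Finset.sum_congr rfl fun y _ => by rw [Γ.dist_comm]
    · simp
  rw [Finset.sum_congr rfl fun z _ => h3 z] at h2
  simp only [← Finset.sum_filter, Finset.sum_const, nsmul_eq_mul, mul_one] at h2
  rwa [kk_eq_card hΓ x, kk_eq_card hΓ x, kk_eq_card hΓ x]

theorem kk_one (hΓ : IsDistanceRegular Γ) (hbip : Γ.IsBipartite) : kk Γ 1 = b Γ 0 := by
  obtain ⟨x⟩ := hΓ.1.nonempty
  rw [← sum_adj_one hΓ hbip x, kk_eq_card hΓ x, ← Finset.sum_filter]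
  simp

theorem kk_mul_b (hΓ : IsDistanceRegular Γ) (hbip : Γ.IsBipartite) {i : ℕ} (hi : i < Γ.diam) :
    kk Γ i * b Γ i = kk Γ (i + 1) * c Γ (i + 1) := by
  induction i with
  | zero => rw [kk_zero hΓ, kk_one hΓ hbip, c_one hΓ (by omega)]; ring
  | succ i ih =>
    have h1 := kk_mul_b_zero hΓ hbip i
    rw [← c_add_b hΓ hbip hi.le] at h1
    have := ih (by omega)
    linarith

theorem kk_pos (hΓ : IsDistanceRegular Γ) (hbip : Γ.IsBipartite) {i : ℕ} (hi : i ≤ Γ.diam) :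
    0 < kk Γ i := by
  induction i with
  | zero => rw [kk_zero hΓ]; exact one_pos
  | succ i ih =>
    have h1 := kk_mul_b hΓ hbip hi
    have h2 := mul_pos (ih (by omega)) (b_pos hΓ hi)
    rw [h1] at h2
    exact pos_of_mul_pos_left h2 (c_pos hΓ (by omega) hi).le

end Counting

/-! ### The algebra spanned by the distance matrices -/

section DistMatrices

variable {X : Type*} [Fintype X] {Γ : SimpleGraph X}

/-- The matrix whose `(y, z)`-entry is `a (∂(y, z))`. -/
noncomputable def ofDist {X : Type*} (Γ : SimpleGraph X) (a : ℕ → ℝ) : Matrix X X ℂ :=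
  Matrix.of fun y z => (a (Γ.dist y z) : ℂ)

theorem ofDist_apply {X : Type*} (Γ : SimpleGraph X) (a : ℕ → ℝ) (y z : X) :
    ofDist Γ a y z = (a (Γ.dist y z) : ℂ) := rfl

theorem distMatrix_eq_ofDist {X : Type*} (Γ : SimpleGraph X) (i : ℕ) :
    distMatrix Γ i = ofDist Γ (fun h => if h = i then 1 else 0) := by
  ext y z
  simp only [distMatrix, ofDist_apply, Matrix.of_apply]
  split_ifs <;> simp

theorem ofDist_add {X : Type*} (Γ : SimpleGraph X) (a a' : ℕ → ℝ) :
    ofDist Γ a + ofDist Γ a' = ofDist Γ (a + a') := by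
  ext y z; simp [ofDist_apply]

theorem smul_ofDist {X : Type*} (Γ : SimpleGraph X) (r : ℝ) (a : ℕ → ℝ) :
    r • ofDist Γ a = ofDist Γ (fun h => r * a h) := by
  ext y z; simp [ofDist_apply]

theorem ofDist_congr (hc : Γ.Connected) {a a' : ℕ → ℝ} (h : ∀ i ≤ Γ.diam, a i = a' i) :
    ofDist Γ a = ofDist Γ a' := by
  ext y z
  rw [ofDist_apply, ofDist_apply, h _ (dist_le_diam_of_connected hc y z)]

theorem ofDist_inj (hc : Γ.Connected) {a a' : ℕ → ℝ} (h : ofDist Γ a = ofDist Γ a') {i : ℕ}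
    (hi : i ≤ Γ.diam) : a i = a' i := by
  obtain ⟨y, z, rfl⟩ := exists_dist_eq hc hi
  have := congrFun (congrFun h y) z
  rw [ofDist_apply, ofDist_apply] at this
  exact_mod_cast this

theorem A_apply {X : Type*} (Γ : SimpleGraph X) (y z : X) :
    A Γ y z = if Γ.dist y z = 1 then 1 else 0 := rfl

theorem A_mul_ofDist (hΓ : IsDistanceRegular Γ) (hbip : Γ.IsBipartite) (a : ℕ → ℝ) :
    A Γ * ofDist Γ a = ofDist Γ (fun h => c Γ h * a (h - 1) + b Γ h * a (h + 1)) := by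
  ext y w
  rw [ofDist_apply, ← sum_adj hΓ hbip, Matrix.mul_apply]
  push_cast
  refine Finset.sum_congr rfl fun z _ => ?_
  rw [A_apply, ofDist_apply]
  split_ifs <;> simp

variable [DecidableEq X]

theorem one_eq_ofDist {X : Type*} [DecidableEq X] {Γ : SimpleGraph X} (hc : Γ.Connected) :
    (1 : Matrix X X ℂ) = ofDist Γ (fun h => if h = 0 then 1 else 0) := by
  ext y z
  simp only [Matrix.one_apply, ofDist_apply, hc.dist_eq_zero_iff]
  split_ifs <;> simp

/-- Multiplying by A raises the top distance by one and multiplies the top coefficient by c_{j+1} ≠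
0. Hence I, A, …, A^D are linearly independent. -/
theorem pow_eq_ofDist (hΓ : IsDistanceRegular Γ) (hbip : Γ.IsBipartite) (j : ℕ) :
    ∃ a : ℕ → ℝ, A Γ ^ j = ofDist Γ a ∧ (∀ h, j < h → a h = 0) ∧ (j ≤ Γ.diam → a j ≠ 0) := by
  induction j with
  | zero =>
    refine ⟨_, by rw [pow_zero, one_eq_ofDist hΓ.1], fun h hh => ?_, fun _ => ?_⟩
    · exact if_neg (by omega)
    · simp
  | succ j ih =>
    obtain ⟨a, h1, h2, h3⟩ := ih
    refine ⟨_, by rw [pow_succ', h1, A_mul_ofDist hΓ hbip], fun h hh => ?_, fun hj => ?_⟩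
    · rw [h2 _ (by omega), h2 _ (by omega)]
      ring
    · rw [h2 (j + 1 + 1) (by omega), mul_zero, add_zero, Nat.add_sub_cancel]
      exact mul_ne_zero (c_pos hΓ (by omega) hj).ne' (h3 (by omega))

theorem aeval_eq_ofDist (hΓ : IsDistanceRegular Γ) (hbip : Γ.IsBipartite) (G : ℝ[X]) :
    ∃ a : ℕ → ℝ, aeval (A Γ) G = ofDist Γ a := by
  induction G using Polynomial.induction_on' with
  | add p q hp hq =>
    obtain ⟨a, ha⟩ := hp
    obtain ⟨a', ha'⟩ := hq
    exact ⟨a + a', by rw [map_add, ha, ha', ofDist_add]⟩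
  | monomial n r =>
    obtain ⟨a, ha, -⟩ := pow_eq_ofDist hΓ hbip n
    exact ⟨_, by rw [aeval_monomial, ha, Algebra.algebraMap_eq_smul_one, smul_mul_assoc, one_mul,
      smul_ofDist]⟩

theorem aeval_ne_zero (hΓ : IsDistanceRegular Γ) (hbip : Γ.IsBipartite) {G : ℝ[X]} (hG : G ≠ 0)
    (hd : G.natDegree ≤ Γ.diam) : aeval (A Γ) G ≠ 0 := by
  intro h0
  choose a h1 h2 h3 using pow_eq_ofDist hΓ hbip
  obtain ⟨y, z, hyz⟩ := exists_dist_eq hΓ.1 hd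
  have h := congrFun (congrFun h0 y) z
  rw [aeval_eq_sum_range, Finset.sum_range_succ, Matrix.add_apply, Matrix.sum_apply,
    Finset.sum_eq_zero, zero_add, Matrix.smul_apply, h1, ofDist_apply, hyz, Matrix.zero_apply,
    smul_eq_zero] at h
  · rcases h with h | h
    · exact hG (leadingCoeff_eq_zero.1 h)
    · exact h3 _ hd (by exact_mod_cast h)
  · intro i hi
    rw [Matrix.smul_apply, h1, ofDist_apply, hyz, h2 _ _ (Finset.mem_range.1 hi)]
    simp

end DistMatrices

/-! ### Recurrences of the polynomials f_i, p_i and P_i -/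

section Polynomials

variable {X : Type*} [Fintype X] {Γ : SimpleGraph X}

theorem X_mul_fPoly_zero (hΓ : IsDistanceRegular Γ) (hD : 1 ≤ Γ.diam) :
    Polynomial.X * fPoly Γ 0 = C (c Γ 1) * fPoly Γ 1 := by
  rw [fPoly, fPoly, mul_one, ← mul_assoc, ← C_mul, mul_inv_cancel₀ (c_pos hΓ le_rfl hD).ne',
    C_1, one_mul]

theorem X_mul_fPoly_succ (hΓ : IsDistanceRegular Γ) {i : ℕ} (hi : i + 2 ≤ Γ.diam) :
    Polynomial.X * fPoly Γ (i + 1) = C (c Γ (i + 2)) * fPoly Γ (i + 2) + C (b Γ i) * fPoly Γ i := by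
  rw [fPoly.eq_3, ← mul_assoc, ← C_mul, mul_inv_cancel₀ (c_pos hΓ (by omega) hi).ne',
    C_1, one_mul, sub_add_cancel]

theorem degree_fPoly (hΓ : IsDistanceRegular Γ) {i : ℕ} (hi : i ≤ Γ.diam) :
    (fPoly Γ i).degree = i := by
  induction i using Nat.strong_induction_on with
  | _ i ih =>
    match i with
    | 0 => rw [fPoly, degree_one]; rfl
    | 1 => rw [fPoly, degree_C_mul (inv_ne_zero (c_pos hΓ le_rfl hi).ne'), degree_X]; rfl
    | i + 2 =>
      have h1 : (Polynomial.X * fPoly Γ (i + 1)).degree = ((i + 2 : ℕ) : WithBot ℕ) := by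
        rw [degree_mul, degree_X, ih (i + 1) (by omega) (by omega)]
        norm_cast
        rw [add_comm 1]
      have h2 : (C (b Γ i) * fPoly Γ i).degree = i := by
        rw [degree_C_mul (b_pos hΓ (by omega)).ne', ih i (by omega) (by omega)]
      rw [fPoly, degree_C_mul (inv_ne_zero (c_pos hΓ (by omega) hi).ne'),
        degree_sub_eq_left_of_degree_lt, h1]
      rw [h1, h2]
      norm_cast
      omega

theorem filter_even_sub (i : ℕ) :
    (Finset.range (i + 2 + 1)).filter (fun h => Even (i + 2 - h)) =
      insert (i + 2) ((Finset.range (i + 1)).filter (fun h => Even (i - h))) := by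
  ext h
  simp only [Finset.mem_filter, Finset.mem_range, Finset.mem_insert]
  grind

theorem sum_filter_even_sub {M : Type*} [AddCommMonoid M] (F : ℕ → M) (i : ℕ) :
    ∑ h ∈ (Finset.range (i + 2 + 1)).filter (fun h => Even (i + 2 - h)), F h =
      F (i + 2) + ∑ h ∈ (Finset.range (i + 1)).filter (fun h => Even (i - h)), F h := by
  rw [filter_even_sub, Finset.sum_insert (by simp)]

theorem sum_filter_even_zero {M : Type*} [AddCommMonoid M] (F : ℕ → M) :
    ∑ h ∈ (Finset.range (0 + 1)).filter (fun h => Even (0 - h)), F h = F 0 := by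
  have : (Finset.range (0 + 1)).filter (fun h => Even (0 - h)) = {0} := by decide
  rw [this, Finset.sum_singleton]

theorem sum_filter_even_one {M : Type*} [AddCommMonoid M] (F : ℕ → M) :
    ∑ h ∈ (Finset.range (1 + 1)).filter (fun h => Even (1 - h)), F h = F 1 := by
  have : (Finset.range (1 + 1)).filter (fun h => Even (1 - h)) = {1} := by decide
  rw [this, Finset.sum_singleton]

theorem pPoly_zero : pPoly Γ 0 = 1 := by rw [pPoly, sum_filter_even_zero, fPoly]

theorem pPoly_one : pPoly Γ 1 = fPoly Γ 1 := by rw [pPoly, sum_filter_even_one]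

theorem pPoly_add_two (i : ℕ) : pPoly Γ (i + 2) = fPoly Γ (i + 2) + pPoly Γ i := by
  rw [pPoly, sum_filter_even_sub, pPoly]

theorem degree_pPoly (hΓ : IsDistanceRegular Γ) {i : ℕ} (hi : i ≤ Γ.diam) :
    (pPoly Γ i).degree = i := by
  induction i using Nat.strong_induction_on with
  | _ i ih =>
    match i with
    | 0 => rw [pPoly_zero, degree_one]; rfl
    | 1 => rw [pPoly_one, degree_fPoly hΓ hi]
    | i + 2 =>
      rw [pPoly_add_two, degree_add_eq_left_of_degree_lt, degree_fPoly hΓ hi]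
      rw [degree_fPoly hΓ hi, ih i (by omega) (by omega)]
      norm_cast
      omega

theorem X_mul_pPoly_zero (hΓ : IsDistanceRegular Γ) (hD : 1 ≤ Γ.diam) :
    Polynomial.X * pPoly Γ 0 = C (c Γ 1) * pPoly Γ 1 := by
  rw [pPoly_one, ← X_mul_fPoly_zero hΓ hD, pPoly_zero, fPoly]

/-- Add the recurrences of the f_h over one parity class: f_{i+2} gets the coefficient c_{i+2}, and
every f_m with m ≤ i gets c_m + b_m, which is the valency because the graph is bipartite. Rewrite
the valency as c_{i+2} + b_{i+2}. -/
theorem X_mul_pPoly_succ (hΓ : IsDistanceRegular Γ) (hbip : Γ.IsBipartite) {i : ℕ}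
    (hi : i + 2 ≤ Γ.diam) :
    Polynomial.X * pPoly Γ (i + 1) =
      C (c Γ (i + 2)) * pPoly Γ (i + 2) + C (b Γ (i + 2)) * pPoly Γ i := by
  induction i using Nat.strong_induction_on with
  | _ i ih =>
    match i with
    | 0 =>
      have hb : C (b Γ 0) = C (c Γ 2) + C (b Γ 2) := by rw [← C_add, c_add_b hΓ hbip hi]
      rw [pPoly_one, X_mul_fPoly_succ hΓ hi, pPoly_add_two, pPoly_zero, fPoly.eq_1, hb]
      ring
    | 1 =>
      have hb : C (c Γ 1) + C (b Γ 1) = C (c Γ 3) + C (b Γ 3) := by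
        rw [← C_add, ← C_add, c_add_b hΓ hbip hi, c_add_b hΓ hbip (by omega)]
      rw [pPoly_add_two, mul_add, X_mul_fPoly_succ hΓ hi, pPoly_add_two, X_mul_pPoly_zero hΓ
        (by omega), pPoly_one]
      linear_combination fPoly Γ 1 * hb
    | i + 2 =>
      have hb : C (c Γ (i + 2)) + C (b Γ (i + 2)) = C (c Γ (i + 4)) + C (b Γ (i + 4)) := by
        rw [← C_add, ← C_add, c_add_b hΓ hbip (by omega), c_add_b hΓ hbip (by omega)]
      rw [show i + 2 + 1 = i + 1 + 2 by omega, pPoly_add_two (i + 1), mul_add,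
        ih i (by omega) (by omega), X_mul_fPoly_succ hΓ (i := i + 2) (by omega),
        pPoly_add_two (i + 2)]
      linear_combination pPoly Γ (i + 2) * hb - C (b Γ (i + 2)) * pPoly_add_two (Γ := Γ) i

theorem PPoly_zero : PPoly Γ 0 = 1 := by
  have h := pPoly_eq_of_even Γ 0 (by simp)
  rw [pPoly_zero, ← expand_eq_comp_X_pow, ← map_one (expand ℝ 2)] at h
  exact (expand_injective two_pos h).symm

theorem PPoly_one (hΓ : IsDistanceRegular Γ) (hD : 1 ≤ Γ.diam) : PPoly Γ 1 = 1 := by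
  have h := pPoly_eq_of_odd Γ 1 (by simp)
  rw [pPoly_one, fPoly, c_one hΓ hD, inv_one, C_1, one_mul, ← expand_eq_comp_X_pow] at h
  refine (expand_injective two_pos ?_).symm
  rw [map_one]
  exact mul_left_cancel₀ (X_ne_zero (R := ℝ)) (by rw [← h, mul_one])

theorem PPoly_succ_of_even (hΓ : IsDistanceRegular Γ) (hbip : Γ.IsBipartite) {i : ℕ}
    (hi : i + 2 ≤ Γ.diam) (he : Even i) :
    Polynomial.X * PPoly Γ (i + 1) =
      C (c Γ (i + 2)) * PPoly Γ (i + 2) + C (b Γ (i + 2)) * PPoly Γ i := by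
  have h := X_mul_pPoly_succ hΓ hbip hi
  rw [pPoly_eq_of_odd Γ (i + 1) (by grind), pPoly_eq_of_even Γ i he,
    pPoly_eq_of_even Γ (i + 2) (by grind)] at h
  simp only [← expand_eq_comp_X_pow] at h
  refine expand_injective two_pos ?_
  simp only [map_add, map_mul, expand_X, expand_C]
  rw [← h]
  ring

theorem PPoly_succ_of_odd (hΓ : IsDistanceRegular Γ) (hbip : Γ.IsBipartite) {i : ℕ}
    (hi : i + 2 ≤ Γ.diam) (he : ¬ Even i) :
    PPoly Γ (i + 1) =
      C (c Γ (i + 2)) * PPoly Γ (i + 2) + C (b Γ (i + 2)) * PPoly Γ i := by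
  have h := X_mul_pPoly_succ hΓ hbip hi
  rw [pPoly_eq_of_even Γ (i + 1) (by grind), pPoly_eq_of_odd Γ i he,
    pPoly_eq_of_odd Γ (i + 2) (by grind)] at h
  simp only [← expand_eq_comp_X_pow] at h
  refine expand_injective two_pos ?_
  simp only [map_add, map_mul, expand_C]
  refine mul_left_cancel₀ (X_ne_zero (R := ℝ)) ?_
  rw [h]
  ring

variable [DecidableEq X]

theorem aeval_fPoly (hΓ : IsDistanceRegular Γ) (hbip : Γ.IsBipartite) {i : ℕ} (hi : i ≤ Γ.diam) :
    aeval (A Γ) (fPoly Γ i) = distMatrix Γ i := by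
  induction i using Nat.strong_induction_on with
  | _ i ih =>
    match i with
    | 0 => rw [fPoly, map_one, one_eq_ofDist hΓ.1, distMatrix_eq_ofDist]
    | 1 => rw [fPoly, c_one hΓ hi]; simp [A]
    | i + 2 =>
      have h := congrArg (aeval (A Γ)) (X_mul_fPoly_succ hΓ hi)
      rw [map_add, map_mul, map_mul, map_mul, aeval_X, ih (i + 1) (by omega) (by omega),
        ih i (by omega) (by omega), aeval_C, aeval_C, Algebra.algebraMap_eq_smul_one,
        Algebra.algebraMap_eq_smul_one, smul_mul_assoc, one_mul, smul_mul_assoc, one_mul,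
        distMatrix_eq_ofDist, distMatrix_eq_ofDist, A_mul_ofDist hΓ hbip] at h
      have hc := (c_pos hΓ (i := i + 2) (by omega) hi).ne'
      have h2 : c Γ (i + 2) • aeval (A Γ) (fPoly Γ (i + 2)) =
          c Γ (i + 2) • distMatrix Γ (i + 2) := by
        rw [← sub_eq_iff_eq_add] at h
        rw [← h, sub_eq_iff_eq_add, distMatrix_eq_ofDist, smul_ofDist, smul_ofDist, ofDist_add]
        congr 1
        funext h
        simp only [Pi.add_apply]
        by_cases h1 : h = i
        · subst h1; simp
        · by_cases h2 : h = i + 2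
          · subst h2; simp
          · rw [if_neg (by omega), if_neg (by omega), if_neg (by omega), if_neg (by omega)]; ring
      exact smul_right_injective _ hc h2

theorem aeval_pPoly (hΓ : IsDistanceRegular Γ) (hbip : Γ.IsBipartite) {i : ℕ} (hi : i ≤ Γ.diam) :
    aeval (A Γ) (pPoly Γ i) = ofDist Γ (fun h => if h ≤ i ∧ Even (i - h) then 1 else 0) := by
  induction i using Nat.strong_induction_on with
  | _ i ih =>
    match i with
    | 0 =>
      rw [pPoly_zero, map_one, one_eq_ofDist hΓ.1]
      congr 1; funext h; congr 1; simp
    | 1 =>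
      rw [pPoly_one, aeval_fPoly hΓ hbip hi, distMatrix_eq_ofDist]
      congr 1; funext h; congr 1; grind
    | i + 2 =>
      rw [pPoly_add_two, map_add, ih i (by omega) (by omega), aeval_fPoly hΓ hbip hi,
        distMatrix_eq_ofDist, ofDist_add]
      congr 1
      funext h
      simp only [Pi.add_apply]
      grind

end Polynomials

/-! ### The spectrum of A: size, bounds, symmetry -/

section Spectrum

variable {X : Type*} [Fintype X] [DecidableEq X] {Γ : SimpleGraph X}

theorem aeval_mulVec_of_eigenvector {M : Matrix X X ℂ} {t : ℂ} {u : X → ℂ} (h : M *ᵥ u = t • u)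
    (G : ℂ[X]) : aeval M G *ᵥ u = G.eval t • u := by
  induction G using Polynomial.induction_on' with
  | add p q hp hq => rw [map_add, Matrix.add_mulVec, hp, hq, eval_add, add_smul]
  | monomial n r =>
    rw [aeval_monomial, eval_monomial, Algebra.algebraMap_eq_smul_one, smul_mul_assoc, one_mul,
      Matrix.smul_mulVec, mul_smul]
    congr 1
    induction n with
    | zero => simp
    | succ n ih => rw [pow_succ, ← Matrix.mulVec_mulVec, h, Matrix.mulVec_smul, ih, smul_smul,
        pow_succ, mul_comm]

theorem aeval_map_ofReal (M : Matrix X X ℂ) (G : ℝ[X]) :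
    aeval M (G.map (algebraMap ℝ ℂ)) = aeval M G :=
  aeval_map_algebraMap ℂ M G

theorem aeval_real_mulVec_of_eigenvector {M : Matrix X X ℂ} {t : ℝ} {u : X → ℂ}
    (h : M *ᵥ u = (t : ℂ) • u) (G : ℝ[X]) : aeval M G *ᵥ u = ((G.eval t : ℝ) : ℂ) • u := by
  rw [← aeval_map_ofReal, aeval_mulVec_of_eigenvector h]
  congr 1
  exact eval_map_apply (algebraMap ℝ ℂ) t

theorem mem_eigenvalueSet_iff_exists {t : ℝ} :
    t ∈ eigenvalueSet Γ ↔ ∃ u, u ≠ 0 ∧ A Γ *ᵥ u = (t : ℂ) • u := by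
  rw [mem_eigenvalueSet_iff]
  constructor
  · intro h
    obtain ⟨u, hu⟩ := h.exists_hasEigenvector
    exact ⟨u, hu.2, by simpa using hu.apply_eq_smul⟩
  · rintro ⟨u, hu, h⟩
    exact Module.End.hasEigenvalue_of_hasEigenvector (x := u)
      ⟨Module.End.mem_eigenspace_iff.2 (by simpa using h), hu⟩

theorem A_mulVec_primIdem {t : ℝ} (ht : t ∈ eigenvalueSet Γ) (u : X → ℂ) :
    A Γ *ᵥ (primIdem Γ t *ᵥ u) = (t : ℂ) • (primIdem Γ t *ᵥ u) := by
  rw [Matrix.mulVec_mulVec, A_mul_primIdem Γ t ht, Matrix.smul_mulVec]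
  rfl

theorem primIdem_mulVec_of_eigenvector {t : ℝ} (ht : t ∈ eigenvalueSet Γ) {u : X → ℂ}
    (h : A Γ *ᵥ u = (t : ℂ) • u) : primIdem Γ t *ᵥ u = u := by
  have h1 : (Lagrange.basis (eigenvalueSet Γ) id t).eval t = 1 :=
    Lagrange.eval_basis_self (v := id) Function.injective_id.injOn ht
  rw [primIdem, aeval_real_mulVec_of_eigenvector h, h1, Complex.ofReal_one, one_smul]

theorem primIdem_ne_zero {t : ℝ} (ht : t ∈ eigenvalueSet Γ) : primIdem Γ t ≠ 0 := by
  obtain ⟨u, hu, h⟩ := mem_eigenvalueSet_iff_exists.1 ht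
  intro h0
  have := primIdem_mulVec_of_eigenvector ht h
  rw [h0, Matrix.zero_mulVec] at this
  exact hu this.symm

theorem primIdem_mul_self {t : ℝ} (ht : t ∈ eigenvalueSet Γ) :
    primIdem Γ t * primIdem Γ t = primIdem Γ t := by
  refine Matrix.toLin'.injective (LinearMap.ext fun u => ?_)
  rw [Matrix.toLin'_apply, Matrix.toLin'_apply, ← Matrix.mulVec_mulVec]
  exact primIdem_mulVec_of_eigenvector ht (A_mulVec_primIdem ht u)

theorem aeval_mulVec_primIdem {t : ℝ} (ht : t ∈ eigenvalueSet Γ) (G : ℝ[X]) (u : X → ℂ) :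
    aeval (A Γ) G *ᵥ (primIdem Γ t *ᵥ u) = ((G.eval t : ℝ) : ℂ) • (primIdem Γ t *ᵥ u) :=
  aeval_real_mulVec_of_eigenvector (A_mulVec_primIdem ht u) G

theorem primIdem_eq_ofDist (hΓ : IsDistanceRegular Γ) (hbip : Γ.IsBipartite) {t : ℝ}
    (ht : t ∈ eigenvalueSet Γ) : ∃ a : ℕ → ℝ, primIdem Γ t = ofDist Γ a ∧
      ∀ h ≤ Γ.diam, t * a h = c Γ h * a (h - 1) + b Γ h * a (h + 1) := by
  obtain ⟨a, ha⟩ := aeval_eq_ofDist hΓ hbip (Lagrange.basis (eigenvalueSet Γ) id t)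
  refine ⟨a, ha, fun h hh => ?_⟩
  have h1 := A_mul_primIdem Γ t ht
  rw [primIdem, ha, A_mul_ofDist hΓ hbip, smul_ofDist] at h1
  exact (ofDist_inj hΓ.1 h1 hh).symm

/-- Upper bound: λ f_D - b_{D-1} f_{D-1} has degree D + 1 and annihilates A, since b_D = 0. Lower
bound: the product of all λ - t over the eigenvalues t annihilates A, which no nonzero polynomial of
degree at most D does. -/
theorem card_eigenvalueSet (hΓ : IsDistanceRegular Γ) (hbip : Γ.IsBipartite)
    (hD : 2 ≤ Γ.diam) : (eigenvalueSet Γ).card = Γ.diam + 1 := by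
  obtain ⟨m, hm⟩ := Nat.exists_eq_add_of_le' hD
  apply le_antisymm
  · have hdeg : (Polynomial.X * fPoly Γ Γ.diam - C (b Γ (m + 1)) * fPoly Γ (m + 1)).degree =
        ((Γ.diam + 1 : ℕ) : WithBot ℕ) := by
      have h1 : (Polynomial.X * fPoly Γ Γ.diam).degree = ((Γ.diam + 1 : ℕ) : WithBot ℕ) := by
        rw [degree_mul, degree_X, degree_fPoly hΓ le_rfl, add_comm]
        rfl
      rw [degree_sub_eq_left_of_degree_lt, h1]
      rw [h1, degree_C_mul (b_pos hΓ (by omega)).ne', degree_fPoly hΓ (by omega)]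
      norm_cast
      omega
    by_contra! hlt
    have hzero := eq_zero_of_degree_lt_of_eval_finset_eq_zero (eigenvalueSet Γ)
      (f := Polynomial.X * fPoly Γ Γ.diam - C (b Γ (m + 1)) * fPoly Γ (m + 1))
      (by rw [hdeg]; exact_mod_cast hlt) (fun t ht => by
        obtain ⟨u, hu, h⟩ := mem_eigenvalueSet_iff_exists.1 ht
        have h2 := aeval_real_mulVec_of_eigenvector h
          (Polynomial.X * fPoly Γ Γ.diam - C (b Γ (m + 1)) * fPoly Γ (m + 1))
        have h3 : aeval (A Γ) (Polynomial.X * fPoly Γ Γ.diam -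
            C (b Γ (m + 1)) * fPoly Γ (m + 1)) = 0 := by
          rw [map_sub, map_mul, map_mul, aeval_X, aeval_fPoly hΓ hbip le_rfl,
            aeval_fPoly hΓ hbip (by omega), distMatrix_eq_ofDist, distMatrix_eq_ofDist,
            A_mul_ofDist hΓ hbip, aeval_C, Algebra.algebraMap_eq_smul_one, smul_mul_assoc,
            one_mul, smul_ofDist, sub_eq_zero]
          refine ofDist_congr hΓ.1 fun i hi => ?_
          rw [hm] at hi ⊢
          by_cases h1 : i = m + 1
          · subst h1; simp
          · by_cases h2 : i = m + 2
            · subst h2; rw [← hm, b_diam hΓ]; simp [hm]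
            · rw [if_neg (by omega), if_neg (by omega), if_neg (by omega)]; ring
        rw [h3, Matrix.zero_mulVec] at h2
        have := (smul_eq_zero.1 h2.symm).resolve_right hu
        exact_mod_cast this)
    rw [hzero, degree_zero] at hdeg
    exact WithBot.bot_ne_coe hdeg
  · by_contra! hlt
    exact aeval_ne_zero hΓ hbip (Lagrange.nodal_ne_zero (s := eigenvalueSet Γ) (v := id))
      (by rw [Lagrange.natDegree_nodal]; omega) (aeval_nodal_eigenvalueSet Γ)

/-- Evaluate the three-term recurrence of the entries of the idempotent at an entry of largest
modulus, where c_m + b_m = b_0. -/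
theorem abs_le_of_mem_eigenvalueSet (hΓ : IsDistanceRegular Γ) (hbip : Γ.IsBipartite) {t : ℝ}
    (ht : t ∈ eigenvalueSet Γ) : |t| ≤ b Γ 0 := by
  obtain ⟨a, ha, hrec⟩ := primIdem_eq_ofDist hΓ hbip ht
  obtain ⟨m, hm, hmax⟩ := Finset.exists_max_image (Finset.range (Γ.diam + 1)) (fun i => |a i|)
    ⟨0, by simp⟩
  have hmD : m ≤ Γ.diam := by simpa [Nat.lt_succ_iff] using hm
  have hmax' : ∀ i ≤ Γ.diam, |a i| ≤ |a m| := fun i hi => hmax i (by simpa [Nat.lt_succ_iff])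
  have hpos : 0 < |a m| := by
    by_contra! h
    refine primIdem_ne_zero ht ?_
    rw [ha]
    have : ofDist Γ a = ofDist Γ fun _ => 0 :=
      ofDist_congr hΓ.1 fun i hi => abs_nonpos_iff.1 ((hmax' i hi).trans h)
    rw [this]
    ext y z
    simp [ofDist_apply]
  have hc : 0 ≤ c Γ m := by
    rcases Nat.eq_zero_or_pos m with rfl | h
    · exact c_zero.ge
    · exact (c_pos hΓ h hmD).le
  have hb : |b Γ m * a (m + 1)| ≤ b Γ m * |a m| := by
    rcases hmD.eq_or_lt with h | h
    · rw [h, b_diam hΓ]; simp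
    · rw [abs_mul, abs_of_pos (b_pos hΓ h)]
      exact mul_le_mul_of_nonneg_left (hmax' _ h) (b_pos hΓ h).le
  have hc' : |c Γ m * a (m - 1)| ≤ c Γ m * |a m| := by
    rw [abs_mul, abs_of_nonneg hc]
    exact mul_le_mul_of_nonneg_left (hmax' _ (by omega)) hc
  refine le_of_mul_le_mul_right ?_ hpos
  calc |t| * |a m| = |c Γ m * a (m - 1) + b Γ m * a (m + 1)| := by rw [← abs_mul, hrec m hmD]
    _ ≤ c Γ m * |a m| + b Γ m * |a m| := (abs_add_le _ _).trans (add_le_add hc' hb)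
    _ = b Γ 0 * |a m| := by rw [← add_mul, c_add_b hΓ hbip hmD]

theorem b_zero_mem_eigenvalueSet (hΓ : IsDistanceRegular Γ) (hbip : Γ.IsBipartite) :
    b Γ 0 ∈ eigenvalueSet Γ := by
  obtain ⟨x⟩ := hΓ.1.nonempty
  refine mem_eigenvalueSet_iff_exists.2 ⟨fun _ => 1, fun h => one_ne_zero (congrFun h x), ?_⟩
  funext y
  rw [← sum_adj_one hΓ hbip y]
  simp only [Matrix.mulVec, dotProduct, A_apply, mul_one, Pi.smul_apply, smul_eq_mul]
  push_cast
  exact Finset.sum_congr rfl fun z _ => by split_ifs <;> simp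

/-- Changing the sign of an eigenvector on one colour class negates its eigenvalue. -/
theorem neg_mem_eigenvalueSet (hΓ : IsDistanceRegular Γ) (hbip : Γ.IsBipartite) {t : ℝ}
    (ht : t ∈ eigenvalueSet Γ) : -t ∈ eigenvalueSet Γ := by
  obtain ⟨x⟩ := hΓ.1.nonempty
  obtain ⟨u, hu, h⟩ := mem_eigenvalueSet_iff_exists.1 ht
  refine mem_eigenvalueSet_iff_exists.2 ⟨fun y => (-1) ^ Γ.dist x y * u y, fun h0 => hu ?_, ?_⟩
  · funext y
    exact (mul_eq_zero.1 (congrFun h0 y)).resolve_left (pow_ne_zero _ (by simp))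
  · funext y
    have h1 := congrFun h y
    simp only [Matrix.mulVec, dotProduct, A_apply, Pi.smul_apply, smul_eq_mul] at h1 ⊢
    have h2 : ∀ z, (if Γ.dist y z = 1 then (1 : ℂ) else 0) * ((-1) ^ Γ.dist x z * u z) =
        -(-1) ^ Γ.dist x y * ((if Γ.dist y z = 1 then (1 : ℂ) else 0) * u z) := by
      intro z
      split_ifs with hz
      · have h3 := dist_of_adj hΓ.1 hbip hz x
        rw [Γ.dist_comm (u := z), Γ.dist_comm (u := y)] at h3
        rcases h3 with h3 | h3
        · rw [h3, pow_succ]; ring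
        · rw [← h3, pow_succ]; ring
      · simp
    rw [Finset.sum_congr rfl fun z _ => h2 z, ← Finset.mul_sum, h1]
    push_cast
    ring

theorem theta_eq_getElem {j : ℕ} (hj : j < (eigenvalueSet Γ).card) :
    theta Γ j = ((eigenvalueSet Γ).sort (· ≥ ·))[j]'(by rwa [Finset.length_sort]) := by
  rw [theta, List.getD_eq_getElem]

theorem theta_mem {j : ℕ} (hj : j < (eigenvalueSet Γ).card) : theta Γ j ∈ eigenvalueSet Γ := by
  rw [theta_eq_getElem hj, ← Finset.mem_sort (· ≥ ·)]
  exact List.getElem_mem _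

theorem theta_lt {i j : ℕ} (hij : i < j) (hj : j < (eigenvalueSet Γ).card) :
    theta Γ j < theta Γ i := by
  rw [theta_eq_getElem hj, theta_eq_getElem (hij.trans hj)]
  exact (Finset.sortedGT_sort _).getElem_gt_getElem_of_lt hij

theorem image_theta :
    (Finset.range (eigenvalueSet Γ).card).image (theta Γ) = eigenvalueSet Γ := by
  refine Finset.eq_of_subset_of_card_le (Finset.image_subset_iff.2 fun j hj =>
    theta_mem (Finset.mem_range.1 hj)) ?_
  rw [Finset.card_image_of_injOn, Finset.card_range]
  intro i hi j hj hij
  simp only [Finset.coe_range, Set.mem_Iio] at hi hj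
  rcases lt_trichotomy i j with h | h | h
  · exact absurd hij (theta_lt h hj).ne'
  · exact h
  · exact absurd hij (theta_lt h hi).ne

theorem sum_eigenvalueSet {M : Type*} [AddCommMonoid M] (F : ℝ → M) :
    ∑ t ∈ eigenvalueSet Γ, F t = ∑ j ∈ Finset.range (eigenvalueSet Γ).card, F (theta Γ j) := by
  conv_lhs => rw [← image_theta]
  refine Finset.sum_image fun i hi j hj hij => ?_
  simp only [Finset.coe_range, Set.mem_Iio] at hi hj
  rcases lt_trichotomy i j with h | h | h
  · exact absurd hij (theta_lt h hj).ne'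
  · exact h
  · exact absurd hij (theta_lt h hi).ne

/-- Both sides enumerate the eigenvalues increasingly in j, and such an enumeration is unique. -/
theorem theta_sub (hΓ : IsDistanceRegular Γ) (hbip : Γ.IsBipartite) (hD : 2 ≤ Γ.diam) {j : ℕ}
    (hj : j ≤ Γ.diam) : theta Γ (Γ.diam - j) = -theta Γ j := by
  have hcard := card_eigenvalueSet hΓ hbip hD
  have h1 := Finset.orderEmbOfFin_unique hcard (f := fun i => theta Γ (Γ.diam - i))
    (fun i => theta_mem (by omega)) (fun i j hij => theta_lt (by
      have := Fin.lt_def.1 hij; omega) (by omega))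
  have h2 := Finset.orderEmbOfFin_unique hcard (f := fun i => -theta Γ i)
    (fun i => neg_mem_eigenvalueSet hΓ hbip (theta_mem (by omega)))
    (fun i j hij => neg_lt_neg (theta_lt (Fin.lt_def.1 hij) (by omega)))
  exact congrFun (h1.trans h2.symm) ⟨j, by omega⟩

theorem theta_zero (hΓ : IsDistanceRegular Γ) (hbip : Γ.IsBipartite) (hD : 2 ≤ Γ.diam) :
    theta Γ 0 = b Γ 0 := by
  have hcard := card_eigenvalueSet hΓ hbip hD
  refine le_antisymm ((le_abs_self _).trans
    (abs_le_of_mem_eigenvalueSet hΓ hbip (theta_mem (by omega)))) ?_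
  have h := b_zero_mem_eigenvalueSet hΓ hbip
  rw [← image_theta, Finset.mem_image] at h
  obtain ⟨j, hj, h⟩ := h
  rw [← h]
  rcases Nat.eq_zero_or_pos j with rfl | h0
  · exact le_rfl
  · exact (theta_lt h0 (Finset.mem_range.1 hj)).le

theorem theta_diam (hΓ : IsDistanceRegular Γ) (hbip : Γ.IsBipartite) (hD : 2 ≤ Γ.diam) :
    theta Γ Γ.diam = -b Γ 0 := by
  rw [← theta_zero hΓ hbip hD, ← theta_sub hΓ hbip hD (Nat.zero_le _), Nat.sub_zero]

theorem sq_theta_lt (hΓ : IsDistanceRegular Γ) (hbip : Γ.IsBipartite) (hD : 2 ≤ Γ.diam) {j : ℕ}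
    (h1 : 1 ≤ j) (hj : j ≤ Γ.diam - 1) : theta Γ j ^ 2 < b Γ 0 ^ 2 := by
  have hcard := card_eigenvalueSet hΓ hbip hD
  refine sq_lt_sq' ?_ ?_
  · rw [← theta_diam hΓ hbip hD]
    exact theta_lt (by omega) (by omega)
  · rw [← theta_zero hΓ hbip hD]
    exact theta_lt (by omega) (by omega)

/-- Symmetry folds the spectrum onto θ_0 > ⋯ > θ_d, which are nonnegative because -θ_d = θ_{D-d} ≤
θ_d. -/
theorem sq_theta_bounds (hΓ : IsDistanceRegular Γ) (hbip : Γ.IsBipartite) (hD : 2 ≤ Γ.diam)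
    {j : ℕ} (h1 : 1 ≤ j) (hj : j ≤ Γ.diam - 1) :
    theta Γ (Γ.diam / 2) ^ 2 ≤ theta Γ j ^ 2 ∧ theta Γ j ^ 2 ≤ theta Γ 1 ^ 2 := by
  have hcard := card_eigenvalueSet hΓ hbip hD
  have hanti : ∀ i j, i ≤ j → j ≤ Γ.diam → theta Γ j ≤ theta Γ i := by
    intro i j hij hj
    rcases hij.eq_or_lt with rfl | h
    · exact le_rfl
    · exact (theta_lt h (by omega)).le
  have key : ∀ j, 1 ≤ j → j ≤ Γ.diam / 2 →
      theta Γ (Γ.diam / 2) ^ 2 ≤ theta Γ j ^ 2 ∧ theta Γ j ^ 2 ≤ theta Γ 1 ^ 2 := by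
    intro j h1 hj
    have h0 : 0 ≤ theta Γ (Γ.diam / 2) := by
      have h2 := theta_sub hΓ hbip hD (j := Γ.diam / 2) (by omega)
      have h3 := hanti (Γ.diam / 2) (Γ.diam - Γ.diam / 2) (by omega) (by omega)
      linarith
    have h2 := hanti j (Γ.diam / 2) hj (by omega)
    have h3 := hanti 1 j h1 (by omega)
    exact ⟨pow_le_pow_left₀ h0 h2 2, pow_le_pow_left₀ (h0.trans h2) h3 2⟩
  by_cases h : j ≤ Γ.diam / 2
  · exact key j h1 h
  · by_cases h' : Γ.diam - j ≤ Γ.diam / 2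
    · have h2 := key (Γ.diam - j) (by omega) h'
      rwa [theta_sub hΓ hbip hD (by omega), neg_sq] at h2
    · omega

end Spectrum

/-! ### The Hermitian norm -/

section Norm

variable {X : Type*} [Fintype X]

/-- The squared Hermitian norm of a vector. -/
noncomputable def normSq (u : X → ℂ) : ℝ := ∑ y, ‖u y‖ ^ 2

theorem star_dotProduct_self (u : X → ℂ) : star u ⬝ᵥ u = (normSq u : ℂ) := by
  rw [normSq, dotProduct]
  push_cast
  exact Finset.sum_congr rfl fun y _ => Complex.conj_mul' (u y)

theorem normSq_nonneg (u : X → ℂ) : 0 ≤ normSq u := Finset.sum_nonneg fun _ _ => sq_nonneg _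

theorem normSq_eq_zero {u : X → ℂ} : normSq u = 0 ↔ u = 0 := by
  rw [normSq, Finset.sum_eq_zero_iff_of_nonneg fun _ _ => sq_nonneg _]
  constructor
  · intro h
    funext y
    simpa using h y (Finset.mem_univ y)
  · rintro rfl
    simp

theorem normSq_pos {u : X → ℂ} (hu : u ≠ 0) : 0 < normSq u :=
  lt_of_le_of_ne (normSq_nonneg u) fun h => hu (normSq_eq_zero.1 h.symm)

end Norm

/-! ### Projections of a local eigenvector onto the eigenspaces of A -/

section QuadraticForm

variable {X : Type*} [Fintype X] [DecidableEq X] {Γ : SimpleGraph X}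

theorem conjTranspose_ofDist {X : Type*} (Γ : SimpleGraph X) (a : ℕ → ℝ) :
    (ofDist Γ a)ᴴ = ofDist Γ a := by
  ext y z
  rw [Matrix.conjTranspose_apply, ofDist_apply, ofDist_apply, Γ.dist_comm (u := z)]
  exact Complex.conj_ofReal _

/-- A diagonal entry of a real symmetric idempotent is the sum of the squares of its row. All
diagonal entries are a_0 here, so a_0 = 0 would make the matrix zero. -/
theorem ofDist_zero_pos {X : Type*} [Fintype X] [Nonempty X] {Γ : SimpleGraph X} {a : ℕ → ℝ}
    (h : ofDist Γ a * ofDist Γ a = ofDist Γ a) (h0 : ofDist Γ a ≠ 0) : 0 < a 0 := by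
  have key : ∀ y, a 0 = ∑ z, a (Γ.dist y z) ^ 2 := by
    intro y
    have := congrFun (congrFun h y) y
    rw [Matrix.mul_apply] at this
    simp only [ofDist_apply, SimpleGraph.dist_self] at this
    rw [← Complex.ofReal_inj, ← this]
    push_cast
    exact Finset.sum_congr rfl fun z _ => by rw [Γ.dist_comm (u := z), sq]
  by_contra! hle
  refine h0 (Matrix.ext fun y z => ?_)
  have h1 : ∑ z, a (Γ.dist y z) ^ 2 = 0 :=
    le_antisymm ((key y).symm.trans_le hle) (Finset.sum_nonneg fun _ _ => sq_nonneg _)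
  rw [Finset.sum_eq_zero_iff_of_nonneg fun _ _ => sq_nonneg _] at h1
  rw [ofDist_apply, pow_eq_zero_iff two_ne_zero |>.1 (h1 z (Finset.mem_univ z))]
  simp

theorem normSq_mulVec_of_idempotent {X : Type*} [Fintype X] {M : Matrix X X ℂ} (h : M * M = M) (hM : Mᴴ = M)
    (u : X → ℂ) : (normSq (M *ᵥ u) : ℂ) = star u ⬝ᵥ (M *ᵥ u) := by
  rw [← star_dotProduct_self, Matrix.star_mulVec, hM, ← Matrix.dotProduct_mulVec,
    Matrix.mulVec_mulVec, h]

/-- The vector `v` lies in `E*_2 V`, is orthogonal to the all-ones vector, and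
`E*_2 A_2 E*_2 v = η v`. -/
structure IsLocalEigenvector (Γ : SimpleGraph X) (x : X) (η : ℝ) (v : X → ℂ) : Prop where
  eq_zero : ∀ y, Γ.dist x y ≠ 2 → v y = 0
  sum_eq_zero : ∑ y, v y = 0
  eigen : ∀ y, Γ.dist x y = 2 → (distMatrix Γ 2 *ᵥ v) y = η * v y

/-- Inside the sphere of radius 2 only the distances 0, 2 and 4 occur; since v sums to zero, the
distance-4 part acts as minus the sum of the other two, that is, as -(1 + η). -/
theorem IsLocalEigenvector.ofDist_mulVec {x : X} {η : ℝ} {v : X → ℂ}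
    (hv : IsLocalEigenvector Γ x η v) (hc : Γ.Connected) (hbip : Γ.IsBipartite) (a : ℕ → ℝ)
    {y : X} (hy : Γ.dist x y = 2) :
    (ofDist Γ a *ᵥ v) y = ((a 0 + η * a 2 - (1 + η) * a 4 : ℝ) : ℂ) * v y := by
  have h1 : ∀ z, ofDist Γ a y z * v z = (a 0 - a 4 : ℂ) * ((1 : Matrix X X ℂ) y z * v z) +
      (a 2 - a 4 : ℂ) * (distMatrix Γ 2 y z * v z) + a 4 * v z := by
    intro z
    by_cases hz : Γ.dist x z = 2
    · have h2 := even_dist_add_dist hc hbip y x z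
      have h3 := hc.dist_triangle (u := y) (v := x) (w := z)
      have h4 := hc.dist_eq_zero_iff (u := y) (v := z)
      rw [Γ.dist_comm (u := y) (v := x), hy, hz] at h2 h3
      rw [ofDist_apply, distMatrix, Matrix.of_apply, Matrix.one_apply]
      simp only [← h4]
      have h5 : Γ.dist y z = 0 ∨ Γ.dist y z = 2 ∨ Γ.dist y z = 4 := by grind
      rcases h5 with h5 | h5 | h5 <;> rw [h5] <;> norm_num <;> ring
    · rw [hv.eq_zero z hz]; ring
  have h2 : (ofDist Γ a *ᵥ v) y = (a 0 - a 4 : ℂ) * ((1 : Matrix X X ℂ) *ᵥ v) y +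
      (a 2 - a 4 : ℂ) * (distMatrix Γ 2 *ᵥ v) y + a 4 * ∑ z, v z := by
    simp only [Matrix.mulVec, dotProduct, Finset.mul_sum, ← Finset.sum_add_distrib]
    exact Finset.sum_congr rfl fun z _ => h1 z
  rw [h2, hv.eigen y hy, hv.sum_eq_zero, Matrix.one_mulVec]
  push_cast
  ring

/-- An orthogonal projection satisfies ‖E v‖² = ⟨v, E v⟩, and v sees only the entries a_0, a_2, a_4
of E. The recurrence of the entries expresses them through a_0 > 0 and t. -/
theorem IsLocalEigenvector.normSq_primIdem {x : X} {η : ℝ} {v : X → ℂ}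
    (hv : IsLocalEigenvector Γ x η v) (hΓ : IsDistanceRegular Γ) (hbip : Γ.IsBipartite)
    (hD : 4 ≤ Γ.diam) {t : ℝ} (ht : t ∈ eigenvalueSet Γ) :
    ∃ r > 0, normSq (primIdem Γ t *ᵥ v) =
      r * (b Γ 0 ^ 2 - t ^ 2) * ((1 + η) * (t ^ 2 - b Γ 2) + b Γ 2 * b Γ 3) * normSq v := by
  obtain ⟨a, ha, hrec⟩ := primIdem_eq_ofDist hΓ hbip ht
  have : Nonempty X := ⟨x⟩
  have ha0 : 0 < a 0 := by
    refine ofDist_zero_pos (Γ := Γ) ?_ ?_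
    · rw [← ha]; exact primIdem_mul_self ht
    · rw [← ha]; exact primIdem_ne_zero ht
  have hb0 := b_pos hΓ (i := 0) (by omega)
  have hb1 := b_pos hΓ (i := 1) (by omega)
  have hb2 := b_pos hΓ (i := 2) (by omega)
  have hb3 := b_pos hΓ (i := 3) (by omega)
  have e1 := c_add_b hΓ hbip (i := 1) (by omega)
  have e2 := c_add_b hΓ hbip (i := 2) (by omega)
  have e3 := c_add_b hΓ hbip (i := 3) (by omega)
  rw [c_one hΓ (by omega)] at e1
  have r0 := hrec 0 (by omega)
  have r1 := hrec 1 (by omega)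
  have r2 := hrec 2 (by omega)
  have r3 := hrec 3 (by omega)
  simp only [c_zero, c_one hΓ (show 1 ≤ Γ.diam by omega), zero_mul, zero_add, one_mul,
    Nat.reduceAdd, Nat.reduceSub] at r0 r1 r2 r3
  -- Eliminate a_1 and a_3; after substituting b_1 = b_0 - 1 and c_i = b_0 - b_i, the resulting
  -- polynomial in t² splits off the factor b_0² - t².
  have hphi : (a 0 + η * a 2 - (1 + η) * a 4) * (b Γ 0 * b Γ 1 * b Γ 2 * b Γ 3) =
      a 0 * (b Γ 0 ^ 2 - t ^ 2) * ((1 + η) * (t ^ 2 - b Γ 2) + b Γ 2 * b Γ 3) := by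
    have s1 : b Γ 0 * a 1 = t * a 0 := r0.symm
    have s2 : b Γ 0 * b Γ 1 * a 2 = (t ^ 2 - b Γ 0) * a 0 := by
      linear_combination -b Γ 0 * r1 + t * s1
    have s3 : b Γ 2 * b Γ 3 * (b Γ 0 * b Γ 1 * a 4) =
        ((t ^ 2 - c Γ 3 * b Γ 2) * (t ^ 2 - b Γ 0) - t ^ 2 * c Γ 2 * b Γ 1) * a 0 := by
      linear_combination (-b Γ 0 * b Γ 1 * b Γ 2) * r3 - t * b Γ 0 * b Γ 1 * r2 +
        (t ^ 2 - c Γ 3 * b Γ 2) * s2 - t * c Γ 2 * b Γ 1 * s1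
    have s2' : b Γ 1 = b Γ 0 - 1 := by linarith
    have s3' : c Γ 2 = b Γ 0 - b Γ 2 := by linarith
    have s4' : c Γ 3 = b Γ 0 - b Γ 3 := by linarith
    rw [s3', s4'] at s3
    linear_combination η * b Γ 2 * b Γ 3 * s2 - (1 + η) * s3 +
      (a 0 * b Γ 0 * b Γ 2 * b Γ 3 + (1 + η) * a 0 * t ^ 2 * (b Γ 0 - b Γ 2)) * s2'
  have hK : 0 < b Γ 0 * b Γ 1 * b Γ 2 * b Γ 3 := by positivity
  refine ⟨a 0 / (b Γ 0 * b Γ 1 * b Γ 2 * b Γ 3), div_pos ha0 hK, ?_⟩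
  have h1 : (normSq (primIdem Γ t *ᵥ v) : ℂ) =
      ((a 0 + η * a 2 - (1 + η) * a 4 : ℝ) : ℂ) * normSq v := by
    rw [normSq_mulVec_of_idempotent (primIdem_mul_self ht) (by rw [ha, conjTranspose_ofDist]),
      ← star_dotProduct_self, dotProduct, dotProduct, Finset.mul_sum]
    refine Finset.sum_congr rfl fun y _ => ?_
    by_cases hy : Γ.dist x y = 2
    · rw [ha, hv.ofDist_mulVec hΓ.1 hbip a hy]; ring
    · simp [hv.eq_zero y hy]
  have h2 : normSq (primIdem Γ t *ᵥ v) = (a 0 + η * a 2 - (1 + η) * a 4) * normSq v := by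
    exact_mod_cast h1
  rw [h2, eq_div_of_mul_eq hK.ne' hphi]
  ring

theorem IsLocalEigenvector.primIdem_mulVec_eq_zero {x : X} {η : ℝ} {v : X → ℂ}
    (hv : IsLocalEigenvector Γ x η v) (hΓ : IsDistanceRegular Γ) (hbip : Γ.IsBipartite)
    (hD : 4 ≤ Γ.diam) {t : ℝ} (ht : t ∈ eigenvalueSet Γ) (ht2 : t ^ 2 = b Γ 0 ^ 2) :
    primIdem Γ t *ᵥ v = 0 := by
  obtain ⟨r, -, h⟩ := hv.normSq_primIdem hΓ hbip hD ht
  rw [← normSq_eq_zero, h, ht2]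
  ring

/-- The affine function L(s) = (1 + η)(s - b_2) + b_2 b_3 is nonnegative at every θ_i² with 1 ≤ i ≤
D - 1. A zero at θ_j² would force a zero at θ_d² (if 1 + η ≥ 0) or at θ_1² (if 1 + η ≤ 0), and L(z²)
= 0 means that the tilde value of z is η. -/
theorem IsLocalEigenvector.E_mulVec_ne_zero {x : X} {η : ℝ} {v : X → ℂ}
    (hv : IsLocalEigenvector Γ x η v) (hΓ : IsDistanceRegular Γ) (hbip : Γ.IsBipartite)
    (hD : 4 ≤ Γ.diam) (hv0 : v ≠ 0) (hη1 : tilde Γ (theta Γ 1) ≠ η)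
    (hηd : tilde Γ (theta Γ (Γ.diam / 2)) ≠ η) {j : ℕ} (hj1 : 1 ≤ j) (hj : j ≤ Γ.diam - 1) :
    E Γ j *ᵥ v ≠ 0 := by
  have hcard := card_eigenvalueSet hΓ hbip (by omega)
  have hb : 0 < b Γ 2 * b Γ 3 := mul_pos (b_pos hΓ (by omega)) (b_pos hΓ (by omega))
  have hnv := normSq_pos hv0
  have nonneg : ∀ i, 1 ≤ i → i ≤ Γ.diam - 1 →
      0 ≤ (1 + η) * (theta Γ i ^ 2 - b Γ 2) + b Γ 2 * b Γ 3 := by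
    intro i h1 hi
    obtain ⟨r, hr, h⟩ := hv.normSq_primIdem hΓ hbip hD (theta_mem (Γ := Γ) (j := i) (by omega))
    have h2 := sub_pos.2 (sq_theta_lt hΓ hbip (by omega) h1 hi)
    have h3 := normSq_nonneg (primIdem Γ (theta Γ i) *ᵥ v)
    rw [h] at h3
    by_contra! hneg
    exact absurd h3 (not_le.2 (mul_neg_of_neg_of_pos (mul_neg_of_pos_of_neg (mul_pos hr h2) hneg)
      hnv))
  have eq_tilde : ∀ z : ℝ, (1 + η) * (z ^ 2 - b Γ 2) + b Γ 2 * b Γ 3 = 0 → tilde Γ z = η := by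
    intro z hz
    have hne : z ^ 2 - b Γ 2 ≠ 0 := by
      intro h0
      rw [h0] at hz
      linarith
    rw [tilde]
    field_simp
    linarith
  intro h0
  obtain ⟨r, hr, h⟩ := hv.normSq_primIdem hΓ hbip hD (theta_mem (Γ := Γ) (j := j) (by omega))
  rw [show normSq (primIdem Γ (theta Γ j) *ᵥ v) = 0 from normSq_eq_zero.2 h0] at h
  have h2 := sub_pos.2 (sq_theta_lt hΓ hbip (by omega) hj1 hj)
  have hL : (1 + η) * (theta Γ j ^ 2 - b Γ 2) + b Γ 2 * b Γ 3 = 0 := by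
    rcases mul_eq_zero.1 h.symm with h' | h'
    · exact (mul_eq_zero.1 h').resolve_left (mul_pos hr h2).ne'
    · exact absurd h' hnv.ne'
  obtain ⟨hlow, hhigh⟩ := sq_theta_bounds hΓ hbip (by omega) hj1 hj
  rcases le_total 0 (1 + η) with hs | hs
  · refine hηd (eq_tilde _ (le_antisymm ?_ (nonneg _ (by omega) (by omega))))
    have := mul_le_mul_of_nonneg_left hlow hs
    linarith
  · refine hη1 (eq_tilde _ (le_antisymm ?_ (nonneg _ (by omega) (by omega))))
    have := mul_le_mul_of_nonpos_left hhigh hs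
    linarith

theorem IsLocalEigenvector.E_zero_mulVec {x : X} {η : ℝ} {v : X → ℂ}
    (hv : IsLocalEigenvector Γ x η v) (hΓ : IsDistanceRegular Γ) (hbip : Γ.IsBipartite)
    (hD : 4 ≤ Γ.diam) : E Γ 0 *ᵥ v = 0 := by
  have hcard := card_eigenvalueSet hΓ hbip (by omega)
  exact hv.primIdem_mulVec_eq_zero hΓ hbip hD (theta_mem (by omega))
    (by rw [theta_zero hΓ hbip (by omega)])

theorem IsLocalEigenvector.E_diam_mulVec {x : X} {η : ℝ} {v : X → ℂ}
    (hv : IsLocalEigenvector Γ x η v) (hΓ : IsDistanceRegular Γ) (hbip : Γ.IsBipartite)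
    (hD : 4 ≤ Γ.diam) : E Γ Γ.diam *ᵥ v = 0 := by
  have hcard := card_eigenvalueSet hΓ hbip (by omega)
  exact hv.primIdem_mulVec_eq_zero hΓ hbip hD (theta_mem (by omega))
    (by rw [theta_diam hΓ hbip (by omega), neg_sq])

theorem IsLocalEigenvector.aeval_mulVec {x : X} {η : ℝ} {v : X → ℂ}
    (hv : IsLocalEigenvector Γ x η v) (hΓ : IsDistanceRegular Γ) (hbip : Γ.IsBipartite)
    (hD : 4 ≤ Γ.diam) (G : ℝ[X]) :
    aeval (A Γ) G *ᵥ v = ∑ j ∈ Finset.Icc 1 (Γ.diam - 1),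
      ((G.eval (theta Γ j) : ℝ) : ℂ) • (E Γ j *ᵥ v) := by
  have : Nonempty X := ⟨x⟩
  have hcard := card_eigenvalueSet hΓ hbip (by omega)
  have h1 : v = ∑ j ∈ Finset.range (Γ.diam + 1), E Γ j *ᵥ v := by
    conv_lhs => rw [← Matrix.one_mulVec v, ← sum_primIdem Γ, sum_eigenvalueSet, hcard]
    exact Matrix.sum_mulVec _ _ _
  have h2 : v = ∑ j ∈ Finset.Icc 1 (Γ.diam - 1), E Γ j *ᵥ v := by
    conv_lhs => rw [h1]
    symm
    refine Finset.sum_subset (fun j hj => ?_) fun j hj hj' => ?_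
    · rw [Finset.mem_Icc] at hj
      rw [Finset.mem_range]
      omega
    · rw [Finset.mem_range] at hj
      rw [Finset.mem_Icc] at hj'
      have : j = 0 ∨ j = Γ.diam := by omega
      rcases this with rfl | rfl
      · exact hv.E_zero_mulVec hΓ hbip hD
      · exact hv.E_diam_mulVec hΓ hbip hD
  conv_lhs => rw [h2, Matrix.mulVec_sum]
  refine Finset.sum_congr rfl fun j hj => ?_
  rw [Finset.mem_Icc] at hj
  exact aeval_mulVec_primIdem (theta_mem (by omega)) G v

/-- Applying E_j to G(A) v = 0 gives G(θ_j) E_j v = 0, so G has D - 1 distinct roots. -/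
theorem eq_zero_of_aeval_mulVec_eq_zero {v : X → ℂ} (hΓ : IsDistanceRegular Γ)
    (hbip : Γ.IsBipartite) (hD : 4 ≤ Γ.diam)
    (hne : ∀ j, 1 ≤ j → j ≤ Γ.diam - 1 → E Γ j *ᵥ v ≠ 0) {G : ℂ[X]}
    (hG : G.degree < ((Γ.diam - 1 : ℕ) : WithBot ℕ)) (h0 : aeval (A Γ) G *ᵥ v = 0) : G = 0 := by
  have hcard := card_eigenvalueSet hΓ hbip (by omega)
  have hinj : Set.InjOn (fun j => (theta Γ j : ℂ)) (Finset.Icc 1 (Γ.diam - 1)) := by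
    intro i hi j hj hij
    simp only [Finset.coe_Icc, Set.mem_Icc] at hi hj
    have hij' : theta Γ i = theta Γ j := Complex.ofReal_injective hij
    rcases lt_trichotomy i j with h | h | h
    · exact absurd hij' (theta_lt h (by omega)).ne'
    · exact h
    · exact absurd hij' (theta_lt h (by omega)).ne
  refine eq_zero_of_degree_lt_of_eval_index_eq_zero _ hinj (by simpa using hG) fun j hj => ?_
  rw [Finset.mem_Icc] at hj
  have hmem := theta_mem (Γ := Γ) (j := j) (by omega)
  have h1 := aeval_mulVec_of_eigenvector (A_mulVec_primIdem hmem v) G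
  have hcomm : aeval (A Γ) G * E Γ j = E Γ j * aeval (A Γ) G := by
    rw [E, primIdem, ← aeval_map_ofReal]
    rw [← map_mul, mul_comm, map_mul]
  have h2 : aeval (A Γ) G *ᵥ (primIdem Γ (theta Γ j) *ᵥ v) = 0 := by
    rw [Matrix.mulVec_mulVec]
    change (aeval (A Γ) G * E Γ j) *ᵥ v = 0
    rw [hcomm, ← Matrix.mulVec_mulVec, h0, Matrix.mulVec_zero]
  rw [h2] at h1
  exact (smul_eq_zero.1 h1.symm).resolve_right (hne j hj.1 hj.2)

end QuadraticForm

/-! ### The two bases of a thin module of endpoint two -/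

section Module

variable {X : Type*} [Fintype X] [DecidableEq X] {Γ : SimpleGraph X} {x : X}
  {W : Submodule ℂ (X → ℂ)}

theorem Estar_mulVec_apply (x : X) (i : ℕ) (u : X → ℂ) (y : X) :
    (Estar Γ x i *ᵥ u) y = if Γ.dist x y = i then u y else 0 := by
  rw [Estar, Matrix.mulVec_diagonal]
  split_ifs <;> simp

theorem mem_EstarSpace {i : ℕ} {u : X → ℂ} :
    u ∈ EstarSpace Γ x i W ↔ ∃ w ∈ W, Estar Γ x i *ᵥ w = u := by
  simp [EstarSpace]

theorem IsTModule.Estar_mulVec_mem (hW : IsTModule Γ x W) (i : ℕ) {w : X → ℂ} (hw : w ∈ W) :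
    Estar Γ x i *ᵥ w ∈ W :=
  hW _ (Algebra.subset_adjoin (Set.mem_insert_of_mem _ ⟨i, rfl⟩)) w hw

theorem IsTModule.aeval_mulVec_mem (hW : IsTModule Γ x W) (G : ℂ[X]) {w : X → ℂ} (hw : w ∈ W) :
    aeval (A Γ) G *ᵥ w ∈ W := by
  refine hW _ ?_ w hw
  exact Algebra.adjoin_mono (by simp) (aeval_mem_adjoin_singleton ℂ (A Γ))

theorem IsTModule.aeval_real_mulVec_mem (hW : IsTModule Γ x W) (G : ℝ[X]) {w : X → ℂ}
    (hw : w ∈ W) : aeval (A Γ) G *ᵥ w ∈ W := by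
  rw [← aeval_map_ofReal]
  exact hW.aeval_mulVec_mem _ hw

theorem Estar_mulVec_eq_zero (hend : HasEndpoint Γ x W 2) {i : ℕ} (hi : i < 2) {w : X → ℂ}
    (hw : w ∈ W) : Estar Γ x i *ᵥ w = 0 := by
  have h1 : EstarSpace Γ x i W = ⊥ := by
    by_contra h
    have := hend.2 ⟨by have := hend.1.1; omega, h⟩
    omega
  have h2 : Estar Γ x i *ᵥ w ∈ EstarSpace Γ x i W := mem_EstarSpace.2 ⟨w, hw, rfl⟩
  rwa [h1, Submodule.mem_bot] at h2

theorem exists_smul_of_finrank_le_one {V : Type*} [AddCommGroup V] [Module ℂ V]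
    [FiniteDimensional ℂ V] {S : Submodule ℂ V} (hS : Module.finrank ℂ S ≤ 1) {a u : V}
    (ha : a ∈ S) (ha0 : a ≠ 0) (hu : u ∈ S) : ∃ e : ℂ, u = e • a := by
  obtain ⟨g, hg⟩ := finrank_le_one_iff.1 hS
  obtain ⟨r, hr⟩ := hg ⟨a, ha⟩
  obtain ⟨s, hs⟩ := hg ⟨u, hu⟩
  have hr' : r • (g : V) = a := congrArg Subtype.val hr
  have hs' : s • (g : V) = u := congrArg Subtype.val hs
  have hr0 : r ≠ 0 := by
    rintro rfl
    rw [zero_smul] at hr'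
    exact ha0 hr'.symm
  exact ⟨s / r, by rw [← hr', ← hs', smul_smul, div_mul_cancel₀ _ hr0]⟩

/-- The sum of the entries of v is the entry of A_2 v at x, and that entry vanishes because E*_0 W =
0. -/
theorem isLocalEigenvector (hΓ : IsDistanceRegular Γ) (hbip : Γ.IsBipartite)
    (hW : IsTModule Γ x W) (hend : HasEndpoint Γ x W 2) {η : ℝ}
    (hη : HasLocalEigenvalue Γ x W η) {v : X → ℂ} (hv : v ∈ EstarSpace Γ x 2 W) :
    IsLocalEigenvector Γ x η v := by
  obtain ⟨w, hw, rfl⟩ := mem_EstarSpace.1 hv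
  have hlev : ∀ y, Γ.dist x y ≠ 2 → (Estar Γ x 2 *ᵥ w) y = 0 := fun y hy => by
    rw [Estar_mulVec_apply, if_neg hy]
  have hE : Estar Γ x 2 *ᵥ (Estar Γ x 2 *ᵥ w) = Estar Γ x 2 *ᵥ w := by
    funext y
    rw [Estar_mulVec_apply]
    split_ifs with h
    · rfl
    · rw [hlev y h]
  have h2 := hη.2 _ hv
  have hmem := hW.Estar_mulVec_mem 2 hw
  generalize Estar Γ x 2 *ᵥ w = v at *
  refine ⟨hlev, ?_, fun y hy => ?_⟩
  · have h0 := congrFun (Estar_mulVec_eq_zero hend two_pos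
      (hW.aeval_real_mulVec_mem (fPoly Γ 2) hmem)) x
    rw [aeval_fPoly hΓ hbip hend.1.1, Estar_mulVec_apply, SimpleGraph.dist_self, if_pos rfl] at h0
    rw [← Pi.zero_apply (M := fun _ : X => ℂ) x, ← h0, Matrix.mulVec, dotProduct]
    refine Finset.sum_congr rfl fun z _ => ?_
    rw [distMatrix, Matrix.of_apply]
    split_ifs with hz
    · rw [one_mul]
    · rw [zero_mul, hlev z hz]
  · have := congrFun h2 y
    rw [← Matrix.mulVec_mulVec, hE, ← Matrix.mulVec_mulVec, Estar_mulVec_apply, if_pos hy] at this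
    exact this

/-- The vector `E*_{i+2} A_i v`. -/
noncomputable def raise (Γ : SimpleGraph X) (x : X) (v : X → ℂ) (i : ℕ) : X → ℂ :=
  (Estar Γ x (i + 2) * distMatrix Γ i) *ᵥ v

theorem raise_apply (v : X → ℂ) (i : ℕ) (y : X) :
    raise Γ x v i y = if Γ.dist x y = i + 2 then (distMatrix Γ i *ᵥ v) y else 0 := by
  rw [raise, ← Matrix.mulVec_mulVec, Estar_mulVec_apply]

theorem raise_apply_of_ne (v : X → ℂ) {i : ℕ} {y : X} (h : Γ.dist x y ≠ i + 2) :
    raise Γ x v i y = 0 := by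
  rw [raise_apply, if_neg h]

theorem raise_mem (hΓ : IsDistanceRegular Γ) (hbip : Γ.IsBipartite) (hW : IsTModule Γ x W)
    {v : X → ℂ} (hv : v ∈ W) {i : ℕ} (hi : i ≤ Γ.diam) :
    raise Γ x v i ∈ EstarSpace Γ x (i + 2) W := by
  refine mem_EstarSpace.2 ⟨_, hW.aeval_real_mulVec_mem (fPoly Γ i) hv, ?_⟩
  rw [aeval_fPoly hΓ hbip hi, raise, Matrix.mulVec_mulVec]

/-- The entry at y adds up v over the vertices z whose distance to y is at most i and of the parity
of i. Let y have distance m from x; the support of v is at distances m - 2, m, m + 2 from y. If m <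
i has the right parity, the whole support is counted and the sum is zero. If m = i + 2, only
distance i counts, which gives w_i. If m > i + 2 or the parity is wrong, nothing counts. The layer m
= i is the last term. -/
theorem aeval_pPoly_mulVec (hΓ : IsDistanceRegular Γ) (hbip : Γ.IsBipartite) {η : ℝ} {v : X → ℂ}
    (hv : IsLocalEigenvector Γ x η v) {i : ℕ} (hi : i ≤ Γ.diam) :
    aeval (A Γ) (pPoly Γ i) *ᵥ v =
      raise Γ x v i + Estar Γ x i *ᵥ (aeval (A Γ) (pPoly Γ i) *ᵥ v) := by
  funext y
  rw [Pi.add_apply, Estar_mulVec_apply]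
  by_cases hy : Γ.dist x y = i
  · rw [if_pos hy, raise_apply_of_ne v (by omega), zero_add]
  rw [if_neg hy, add_zero, raise_apply, aeval_pPoly hΓ hbip hi, Matrix.mulVec, dotProduct]
  have hpar : ∀ z, Γ.dist x z = 2 → Even (Γ.dist y z + Γ.dist x y) ∧
      Γ.dist x y ≤ Γ.dist y z + 2 ∧ Γ.dist y z ≤ Γ.dist x y + 2 := by
    intro z hz
    have h1 := even_dist_add_dist hΓ.1 hbip x y z
    have h2 := hΓ.1.dist_triangle (u := y) (v := x) (w := z)
    have h3 := hΓ.1.dist_triangle (u := x) (v := z) (w := y)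
    rw [Γ.dist_comm (u := y) (v := x)] at h2
    rw [Γ.dist_comm (u := z) (v := y)] at h3
    rw [hz] at h1 h2 h3
    refine ⟨by grind, by omega, by omega⟩
  split_ifs with h
  · rw [Matrix.mulVec, dotProduct]
    refine Finset.sum_congr rfl fun z _ => ?_
    by_cases hz : Γ.dist x z = 2
    · have h1 := hpar z hz
      rw [ofDist_apply, distMatrix, Matrix.of_apply]
      by_cases h2 : Γ.dist y z = i
      · simp [h2]
      · rw [if_neg (by omega), if_neg h2, Complex.ofReal_zero]
    · rw [hv.eq_zero z hz, mul_zero, mul_zero]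
  · by_cases hlt : Γ.dist x y < i ∧ Even (Γ.dist x y + i)
    · rw [← hv.sum_eq_zero]
      refine Finset.sum_congr rfl fun z _ => ?_
      by_cases hz : Γ.dist x z = 2
      · have h1 := hpar z hz
        rw [ofDist_apply, if_pos (by grind), Complex.ofReal_one, one_mul]
      · rw [hv.eq_zero z hz, mul_zero]
    · refine Finset.sum_eq_zero fun z _ => ?_
      by_cases hz : Γ.dist x z = 2
      · have h1 := hpar z hz
        rw [ofDist_apply, if_neg (by grind), Complex.ofReal_zero, zero_mul]
      · rw [hv.eq_zero z hz, mul_zero]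

theorem raise_zero (hΓ : IsDistanceRegular Γ) {η : ℝ} {v : X → ℂ}
    (hv : IsLocalEigenvector Γ x η v) : raise Γ x v 0 = v := by
  funext y
  rw [raise_apply, distMatrix_eq_ofDist, ← one_eq_ofDist hΓ.1, Matrix.one_mulVec]
  split_ifs with h
  · rfl
  · rw [hv.eq_zero y h]

theorem degree_map_ofReal (G : ℝ[X]) : (G.map (algebraMap ℝ ℂ)).degree = G.degree :=
  degree_map G _

/-- In a thin module each `E*_{i+2} A_i v` is a polynomial of degree `i` in `A` applied to `v`. -/
theorem exists_raise_eq_aeval (hΓ : IsDistanceRegular Γ) (hbip : Γ.IsBipartite)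
    (hD : 4 ≤ Γ.diam) (hW : IsTModule Γ x W) (hthin : IsThin Γ x W)
    (hend : HasEndpoint Γ x W 2) {η : ℝ} {v : X → ℂ} (hv : IsLocalEigenvector Γ x η v)
    (hvW : v ∈ W) (hne : ∀ j, 1 ≤ j → j ≤ Γ.diam - 1 → E Γ j *ᵥ v ≠ 0) {i : ℕ}
    (hi : i ≤ Γ.diam - 2) :
    raise Γ x v i ≠ 0 ∧ ∃ G : ℂ[X], G.degree = i ∧ aeval (A Γ) G *ᵥ v = raise Γ x v i := by
  induction i using Nat.strong_induction_on with
  | _ i ih =>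
    have hmain : ∃ G : ℂ[X], G.degree = i ∧ aeval (A Γ) G *ᵥ v = raise Γ x v i := by
      have hp := aeval_pPoly_mulVec hΓ hbip hv (i := i) (by omega)
      have hpW := hW.aeval_real_mulVec_mem (pPoly Γ i) hvW
      by_cases h2 : i < 2
      · rw [Estar_mulVec_eq_zero hend h2 hpW, add_zero] at hp
        refine ⟨(pPoly Γ i).map (algebraMap ℝ ℂ), ?_, ?_⟩
        · rw [degree_map_ofReal, degree_pPoly hΓ (by omega)]
        · rw [aeval_map_ofReal, hp]
      · obtain ⟨i, rfl⟩ := Nat.exists_eq_add_of_le' (not_lt.1 h2)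
        obtain ⟨h0, G, hG, hGv⟩ := ih i (by omega) (by omega)
        obtain ⟨e, he⟩ := exists_smul_of_finrank_le_one (hthin (i + 2) (by omega))
          (raise_mem hΓ hbip hW hvW (by omega)) h0 (mem_EstarSpace.2 ⟨_, hpW, rfl⟩)
        refine ⟨(pPoly Γ (i + 2)).map (algebraMap ℝ ℂ) - C e * G, ?_, ?_⟩
        · rw [degree_sub_eq_left_of_degree_lt, degree_map_ofReal, degree_pPoly hΓ (by omega)]
          rw [degree_map_ofReal, degree_pPoly hΓ (by omega)]
          rw [← smul_eq_C_mul]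
          refine (degree_smul_le e G).trans_lt ?_
          rw [hG]
          norm_cast
          omega
        · rw [map_sub, Matrix.sub_mulVec, map_mul, aeval_C, Algebra.algebraMap_eq_smul_one,
            smul_mul_assoc, one_mul, Matrix.smul_mulVec, hGv, ← he, aeval_map_ofReal]
          exact sub_eq_of_eq_add hp
    refine ⟨fun h0 => ?_, hmain⟩
    obtain ⟨G, hG, hGv⟩ := hmain
    -- The degree i ≤ D - 2 is below D - 1, so a polynomial of this exact degree cannot kill v.
    have := eq_zero_of_aeval_mulVec_eq_zero hΓ hbip hD hne (G := G)
      (by rw [hG]; norm_cast; omega) (by rw [hGv, h0])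
    rw [this, degree_zero] at hG
    exact WithBot.bot_ne_coe hG

theorem isBasisOf_raise (hΓ : IsDistanceRegular Γ) (hbip : Γ.IsBipartite)
    (hD : 4 ≤ Γ.diam) (hW : IsTModule Γ x W) (hthin : IsThin Γ x W)
    (hend : HasEndpoint Γ x W 2) {v : X → ℂ} (hvW : v ∈ W)
    (hne : ∀ i ≤ Γ.diam - 2, raise Γ x v i ≠ 0) :
    IsBasisOf W (fun i : Fin (Γ.diam - 1) => raise Γ x v i) := by
  constructor
  · rw [Fintype.linearIndependent_iff]
    intro g hg i
    obtain ⟨y, hy⟩ := Function.ne_iff.1 (hne i (by omega))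
    have hyd : Γ.dist x y = i + 2 := by
      by_contra h
      exact hy (raise_apply_of_ne v h)
    have h := congrFun hg y
    rw [Finset.sum_apply, Finset.sum_eq_single i] at h
    · exact (mul_eq_zero.1 h).resolve_right hy
    · intro j _ hj
      have : (j : ℕ) ≠ i := fun h => hj (Fin.ext h)
      rw [Pi.smul_apply, raise_apply_of_ne v (by omega), smul_zero]
    · simp
  · apply le_antisymm
    · rw [Submodule.span_le]
      rintro _ ⟨i, rfl⟩
      obtain ⟨w, hw, h⟩ := mem_EstarSpace.1 (raise_mem hΓ hbip hW hvW (i := i) (by omega))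
      change raise Γ x v i ∈ W
      rw [← h]
      exact hW.Estar_mulVec_mem _ hw
    · intro w hw
      have hsum : w = ∑ j ∈ Finset.range (Γ.diam + 1), Estar Γ x j *ᵥ w := by
        funext y
        rw [Finset.sum_apply, Finset.sum_eq_single (Γ.dist x y)]
        · rw [Estar_mulVec_apply, if_pos rfl]
        · intro j _ hj
          rw [Estar_mulVec_apply, if_neg (Ne.symm hj)]
        · intro h
          have := dist_le_diam_of_connected hΓ.1 x y
          rw [Finset.mem_range] at h
          omega
      rw [hsum]
      refine Submodule.sum_mem _ fun j hj => ?_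
      rw [Finset.mem_range] at hj
      by_cases h2 : j < 2
      · rw [Estar_mulVec_eq_zero hend h2 hw]
        exact Submodule.zero_mem _
      · obtain ⟨j, rfl⟩ := Nat.exists_eq_add_of_le' (not_lt.1 h2)
        obtain ⟨e, he⟩ := exists_smul_of_finrank_le_one (hthin (j + 2) (by omega))
          (raise_mem hΓ hbip hW hvW (i := j) (by omega)) (hne j (by omega))
          (mem_EstarSpace.2 ⟨w, hw, rfl⟩)
        rw [he]
        exact Submodule.smul_mem _ e (Submodule.subset_span ⟨⟨j, by omega⟩, rfl⟩)

/-- Eigenvectors for distinct eigenvalues are independent; they span because the basis `u` has as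
many elements. -/
theorem isBasisOf_E (hΓ : IsDistanceRegular Γ) (hbip : Γ.IsBipartite)
    (hD : 4 ≤ Γ.diam) (hW : IsTModule Γ x W) {v : X → ℂ} (hvW : v ∈ W)
    (hne : ∀ j, 1 ≤ j → j ≤ Γ.diam - 1 → E Γ j *ᵥ v ≠ 0) {u : Fin (Γ.diam - 1) → X → ℂ}
    (hu : IsBasisOf W u) : IsBasisOf W (fun j : Fin (Γ.diam - 1) => E Γ (j + 1) *ᵥ v) := by
  have hcard := card_eigenvalueSet hΓ hbip (by omega)
  have hli : LinearIndependent ℂ (fun j : Fin (Γ.diam - 1) => E Γ (j + 1) *ᵥ v) := by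
    refine Module.End.eigenvectors_linearIndependent' (Matrix.toLin' (A Γ))
      (fun j : Fin (Γ.diam - 1) => (theta Γ (j + 1) : ℂ)) ?_ _ ?_
    · intro i j hij
      have hij' : theta Γ (i + 1) = theta Γ (j + 1) := Complex.ofReal_injective hij
      rcases lt_trichotomy (i : ℕ) j with h | h | h
      · exact absurd hij' (theta_lt (by omega) (by omega)).ne'
      · exact Fin.ext h
      · exact absurd hij' (theta_lt (by omega) (by omega)).ne
    · intro j
      refine ⟨Module.End.mem_eigenspace_iff.2 ?_, hne _ (by omega) (by omega)⟩
      rw [Matrix.toLin'_apply]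
      exact A_mulVec_primIdem (theta_mem (by omega)) v
  refine ⟨hli, Submodule.eq_of_le_of_finrank_eq ?_ ?_⟩
  · rw [Submodule.span_le]
    rintro _ ⟨j, rfl⟩
    exact hW.aeval_real_mulVec_mem _ hvW
  · rw [finrank_span_eq_card hli, ← hu.2, finrank_span_eq_card hu.1]

end Module

/-! ### The action of A on the vectors E*_{i+2} A_i v -/

section Recurrences

variable {X : Type*} [Fintype X] [DecidableEq X] {Γ : SimpleGraph X} {x : X}
  {W : Submodule ℂ (X → ℂ)}

theorem A_mulVec_apply_eq_zero {X : Type*} [Fintype X] {Γ : SimpleGraph X} {x : X} (hc : Γ.Connected) (hbip : Γ.IsBipartite) {m : ℕ} {u : X → ℂ}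
    (hu : ∀ y, Γ.dist x y ≠ m → u y = 0) {y : X} (h1 : Γ.dist x y ≠ m + 1)
    (h2 : Γ.dist x y + 1 ≠ m) : (A Γ *ᵥ u) y = 0 := by
  rw [Matrix.mulVec, dotProduct]
  refine Finset.sum_eq_zero fun z _ => ?_
  rw [A_apply]
  split_ifs with hz
  · have h3 := dist_of_adj hc hbip hz x
    rw [Γ.dist_comm (u := z), Γ.dist_comm (u := y)] at h3
    rw [hu z (by omega), mul_zero]
  · rw [zero_mul]

theorem aeval_C_mul_mulVec (M : Matrix X X ℂ) (r : ℝ) (G : ℝ[X]) (v : X → ℂ) :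
    aeval M (C r * G) *ᵥ v = (r : ℂ) • (aeval M G *ᵥ v) := by
  rw [map_mul, aeval_C, Algebra.algebraMap_eq_smul_one, smul_mul_assoc, one_mul,
    Matrix.smul_mulVec]
  rfl

theorem A_mulVec_aeval_pPoly (hΓ : IsDistanceRegular Γ) (hbip : Γ.IsBipartite) {i : ℕ}
    (hi : i + 2 ≤ Γ.diam) (v : X → ℂ) :
    A Γ *ᵥ (aeval (A Γ) (pPoly Γ (i + 1)) *ᵥ v) =
      (c Γ (i + 2) : ℂ) • (aeval (A Γ) (pPoly Γ (i + 2)) *ᵥ v) +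
        (b Γ (i + 2) : ℂ) • (aeval (A Γ) (pPoly Γ i) *ᵥ v) := by
  rw [← aeval_C_mul_mulVec, ← aeval_C_mul_mulVec, ← Matrix.add_mulVec, ← map_add,
    ← X_mul_pPoly_succ hΓ hbip hi, map_mul, aeval_X, Matrix.mulVec_mulVec]

theorem aeval_pPoly_apply_of_ne (hΓ : IsDistanceRegular Γ) (hbip : Γ.IsBipartite) {η : ℝ}
    {v : X → ℂ} (hv : IsLocalEigenvector Γ x η v) {i : ℕ} (hi : i ≤ Γ.diam) {y : X}
    (hy : Γ.dist x y ≠ i) : (aeval (A Γ) (pPoly Γ i) *ᵥ v) y = raise Γ x v i y := by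
  rw [aeval_pPoly_mulVec hΓ hbip hv hi, Pi.add_apply, Estar_mulVec_apply, if_neg hy, add_zero]

theorem aeval_pPoly_mulVec_of_lt (hΓ : IsDistanceRegular Γ) (hbip : Γ.IsBipartite)
    (hW : IsTModule Γ x W) (hend : HasEndpoint Γ x W 2) {η : ℝ} {v : X → ℂ}
    (hv : IsLocalEigenvector Γ x η v) (hvW : v ∈ W) {i : ℕ} (hi : i < 2) :
    aeval (A Γ) (pPoly Γ i) *ᵥ v = raise Γ x v i := by
  have h2 := hend.1.1
  rw [aeval_pPoly_mulVec hΓ hbip hv (by omega),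
    Estar_mulVec_eq_zero hend hi (hW.aeval_real_mulVec_mem _ hvW), add_zero]

theorem A_mulVec_raise_zero (hΓ : IsDistanceRegular Γ) (hbip : Γ.IsBipartite)
    (hW : IsTModule Γ x W) (hend : HasEndpoint Γ x W 2) {η : ℝ} {v : X → ℂ}
    (hv : IsLocalEigenvector Γ x η v) (hvW : v ∈ W) :
    A Γ *ᵥ raise Γ x v 0 = (c Γ 1 : ℂ) • raise Γ x v 1 := by
  have h2 := hend.1.1
  rw [← aeval_pPoly_mulVec_of_lt hΓ hbip hW hend hv hvW zero_lt_two,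
    ← aeval_pPoly_mulVec_of_lt hΓ hbip hW hend hv hvW one_lt_two, ← aeval_C_mul_mulVec,
    ← X_mul_pPoly_zero hΓ (by omega), map_mul, aeval_X, Matrix.mulVec_mulVec]

/-- A w_{i+1} lives in layers i + 2 and i + 4. Thinness handles the lower layer. In the upper one,
w_{i+1} may be replaced by p_{i+1}(A) v, since their difference lies in layer i + 1, and the
recurrence of p_i applies. -/
theorem A_mulVec_raise_succ (hΓ : IsDistanceRegular Γ) (hbip : Γ.IsBipartite)
    (hW : IsTModule Γ x W) (hthin : IsThin Γ x W) {η : ℝ} {v : X → ℂ}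
    (hv : IsLocalEigenvector Γ x η v) (hvW : v ∈ W) {i : ℕ} (hi : i + 2 ≤ Γ.diam)
    (h0 : raise Γ x v i ≠ 0) : ∃ β : ℂ, A Γ *ᵥ raise Γ x v (i + 1) =
      (c Γ (i + 2) : ℂ) • raise Γ x v (i + 2) + β • raise Γ x v i := by
  have hmem : A Γ *ᵥ raise Γ x v (i + 1) ∈ W := by
    obtain ⟨w, hw, h⟩ := mem_EstarSpace.1 (raise_mem hΓ hbip hW hvW (i := i + 1) (by omega))
    rw [← h, ← aeval_X (R := ℂ) (A Γ)]
    exact hW.aeval_mulVec_mem _ (hW.Estar_mulVec_mem _ hw)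
  obtain ⟨β, hβ⟩ := exists_smul_of_finrank_le_one (hthin (i + 2) (by omega))
    (raise_mem hΓ hbip hW hvW (by omega)) h0 (mem_EstarSpace.2 ⟨_, hmem, rfl⟩)
  refine ⟨β, funext fun y => ?_⟩
  simp only [Pi.add_apply, Pi.smul_apply, smul_eq_mul]
  by_cases h1 : Γ.dist x y = i + 2
  · have := congrFun hβ y
    rw [Estar_mulVec_apply, if_pos h1] at this
    rw [this, raise_apply_of_ne (i := i + 2) v (by omega)]
    simp
  rw [raise_apply_of_ne (i := i) v h1, mul_zero, add_zero]
  by_cases h2 : Γ.dist x y = i + 4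
  · have h3 := congrFun (A_mulVec_aeval_pPoly hΓ hbip hi v) y
    rw [aeval_pPoly_mulVec hΓ hbip hv (i := i + 1) (by omega), Matrix.mulVec_add, Pi.add_apply,
      A_mulVec_apply_eq_zero (m := i + 1) (u := Estar Γ x (i + 1) *ᵥ _) hΓ.1 hbip
        (fun z hz => by rw [Estar_mulVec_apply, if_neg hz]) (by omega) (by omega), add_zero] at h3
    rw [h3]
    simp only [Pi.add_apply, Pi.smul_apply, smul_eq_mul]
    rw [aeval_pPoly_apply_of_ne hΓ hbip hv hi (by omega),
      aeval_pPoly_apply_of_ne hΓ hbip hv (i := i) (by omega) (by omega),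
      raise_apply_of_ne (i := i) v (by omega), mul_zero, add_zero]
  · rw [raise_apply_of_ne (i := i + 2) v h2, mul_zero,
      A_mulVec_apply_eq_zero (m := i + 3) hΓ.1 hbip
        (fun z hz => raise_apply_of_ne v hz) (by omega) (by omega)]

theorem star_raise_dotProduct_raise (v : X → ℂ) {i j : ℕ} (h : i ≠ j) :
    star (raise Γ x v i) ⬝ᵥ raise Γ x v j = 0 := by
  refine Finset.sum_eq_zero fun y _ => ?_
  by_cases hy : Γ.dist x y = i + 2
  · rw [raise_apply_of_ne (i := j) v (by omega), mul_zero]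
  · rw [Pi.star_apply, raise_apply_of_ne (i := i) v hy, star_zero, zero_mul]

theorem star_dotProduct_A_mulVec {X : Type*} [Fintype X] {Γ : SimpleGraph X} (u w : X → ℂ) :
    star u ⬝ᵥ (A Γ *ᵥ w) = star (A Γ *ᵥ u) ⬝ᵥ w := by
  rw [Matrix.star_mulVec, (A_isHermitian Γ).eq, Matrix.dotProduct_mulVec]

/-- The coefficients `e_i` and `β_i` in `p_{i+2}(A) v = w_{i+2} + e_i w_i` and
`A w_{i+1} = c_{i+2} w_{i+2} + β_i w_i`, where `w_i = E*_{i+2} A_i v`, and their recurrences. -/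
theorem exists_raise_coefficients (hΓ : IsDistanceRegular Γ) (hbip : Γ.IsBipartite)
    (hD : 4 ≤ Γ.diam) (hW : IsTModule Γ x W) (hthin : IsThin Γ x W)
    (hend : HasEndpoint Γ x W 2) {η : ℝ} {v : X → ℂ} (hv : IsLocalEigenvector Γ x η v)
    (hvW : v ∈ W) (hne : ∀ i ≤ Γ.diam - 2, raise Γ x v i ≠ 0) :
    ∃ e β : ℕ → ℂ,
      (∀ i, i + 2 ≤ Γ.diam → aeval (A Γ) (pPoly Γ (i + 2)) *ᵥ v =
        raise Γ x v (i + 2) + e i • raise Γ x v i) ∧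
      (∀ i, i + 3 ≤ Γ.diam → β i ≠ 0) ∧
      e 0 = 1 + η ∧ β 0 = c Γ 2 * e 0 + b Γ 2 ∧
      (∀ i, i + 4 ≤ Γ.diam →
        β (i + 1) + e i * c Γ (i + 1) = c Γ (i + 3) * e (i + 1) + b Γ (i + 3)) ∧
      (∀ i, i + 4 ≤ Γ.diam → e (i + 1) * β i = b Γ (i + 4) * e i) := by
  have he : ∀ i, ∃ e : ℂ, i + 2 ≤ Γ.diam → aeval (A Γ) (pPoly Γ (i + 2)) *ᵥ v =
      raise Γ x v (i + 2) + e • raise Γ x v i := by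
    intro i
    by_cases hi : i + 2 ≤ Γ.diam
    · obtain ⟨e, he⟩ := exists_smul_of_finrank_le_one (hthin (i + 2) (by omega))
        (raise_mem hΓ hbip hW hvW (by omega)) (hne i (by omega))
        (mem_EstarSpace.2 ⟨_, hW.aeval_real_mulVec_mem (pPoly Γ (i + 2)) hvW, rfl⟩)
      exact ⟨e, fun _ => by rw [← he, ← aeval_pPoly_mulVec hΓ hbip hv hi]⟩
    · exact ⟨0, fun h => absurd h hi⟩
  have hβ : ∀ i, ∃ β : ℂ, i + 2 ≤ Γ.diam → A Γ *ᵥ raise Γ x v (i + 1) =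
      (c Γ (i + 2) : ℂ) • raise Γ x v (i + 2) + β • raise Γ x v i := by
    intro i
    by_cases hi : i + 2 ≤ Γ.diam
    · obtain ⟨β, hβ⟩ := A_mulVec_raise_succ hΓ hbip hW hthin hv hvW hi (hne i (by omega))
      exact ⟨β, fun _ => hβ⟩
    · exact ⟨0, fun h => absurd h hi⟩
  choose e he using he
  choose β hβ using hβ
  have hA0 := A_mulVec_raise_zero hΓ hbip hW hend hv hvW
  have hex : ∀ i, i ≤ Γ.diam - 2 → ∃ y, Γ.dist x y = i + 2 ∧ raise Γ x v i y ≠ 0 := by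
    intro i hi
    obtain ⟨y, hy⟩ := Function.ne_iff.1 (hne i hi)
    exact ⟨y, by_contra fun h => hy (raise_apply_of_ne v h), hy⟩
  have hup : ∀ i, i + 1 ≤ Γ.diam → ∀ y, Γ.dist x y = i + 3 →
      (A Γ *ᵥ raise Γ x v i) y = c Γ (i + 1) * raise Γ x v (i + 1) y := by
    intro i hi y hy
    cases i with
    | zero => rw [hA0]; rfl
    | succ i =>
      rw [hβ i hi]
      simp only [Pi.add_apply, Pi.smul_apply, smul_eq_mul]
      rw [raise_apply_of_ne (i := i) v (by omega), mul_zero, add_zero]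
  refine ⟨e, β, he, ?_, ?_, ?_, ?_, ?_⟩
  -- A is Hermitian: ⟨w_i, A w_{i+1}⟩ = β_i ‖w_i‖², while ⟨A w_i, w_{i+1}⟩ = c_{i+1} ‖w_{i+1}‖² ≠ 0.
  · intro i hi h0
    have h1 := star_dotProduct_A_mulVec (Γ := Γ) (raise Γ x v i) (raise Γ x v (i + 1))
    have h2 : star (A Γ *ᵥ raise Γ x v i) ⬝ᵥ raise Γ x v (i + 1) =
        c Γ (i + 1) * normSq (raise Γ x v (i + 1)) := by
      rw [← star_dotProduct_self]
      cases i with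
      | zero =>
        rw [hA0, star_smul, smul_dotProduct, smul_eq_mul]
        congr 1
        exact Complex.conj_ofReal _
      | succ i =>
        rw [hβ i (by omega), star_add, add_dotProduct, star_smul, smul_dotProduct, star_smul,
          smul_dotProduct, star_raise_dotProduct_raise (i := i) (j := i + 1 + 1) v (by omega),
          smul_zero, add_zero,
          smul_eq_mul]
        congr 1
        exact Complex.conj_ofReal _
    rw [h2, hβ i (by omega), h0, zero_smul, add_zero, dotProduct_smul,
      star_raise_dotProduct_raise v (by omega), smul_zero] at h1
    refine mul_ne_zero ?_ ?_ h1.symm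
    · exact_mod_cast (c_pos hΓ (by omega) (by omega)).ne'
    · exact_mod_cast (normSq_pos (hne (i + 1) (by omega))).ne'
  -- In layer 2, p_2(A) = A_0 + A_2 acts on v as 1 + η.
  · obtain ⟨y, hy, hy0⟩ := hex 0 (by omega)
    have h1 := congrFun (he 0 (by omega)) y
    simp only [Pi.add_apply, Pi.smul_apply, smul_eq_mul] at h1
    rw [aeval_pPoly hΓ hbip (by omega), hv.ofDist_mulVec hΓ.1 hbip _ hy,
      raise_apply_of_ne (i := 0 + 2) v (by omega), zero_add] at h1
    rw [raise_zero hΓ hv] at h1 hy0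
    refine mul_right_cancel₀ hy0 (((zero_add _).symm.trans h1.symm).trans ?_)
    congr 1
    norm_num
  · obtain ⟨y, hy, hy0⟩ := hex 0 (by omega)
    have h1 := congrFun (A_mulVec_aeval_pPoly hΓ hbip (i := 0) (by omega) v) y
    rw [aeval_pPoly_mulVec_of_lt (i := 0 + 1) hΓ hbip hW hend hv hvW (by omega),
      aeval_pPoly_mulVec_of_lt (i := 0) hΓ hbip hW hend hv hvW (by omega), hβ 0 (by omega),
      he 0 (by omega)] at h1
    simp only [Pi.add_apply, Pi.smul_apply, smul_eq_mul] at h1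
    rw [raise_apply_of_ne (i := 0 + 2) v (by omega)] at h1
    refine mul_right_cancel₀ hy0 ?_
    linear_combination h1
  -- Coefficient of w_{i+1} in A p_{i+2}(A) v = c_{i+3} p_{i+3}(A) v + b_{i+3} p_{i+1}(A) v.
  · intro i hi
    obtain ⟨y, hy, hy0⟩ := hex (i + 1) (by omega)
    have h1 := congrFun (A_mulVec_aeval_pPoly hΓ hbip (i := i + 1) (by omega) v) y
    rw [he i (by omega), he (i + 1) (by omega), Matrix.mulVec_add, Matrix.mulVec_smul,
      hβ (i + 1) (by omega)] at h1
    simp only [Pi.add_apply, Pi.smul_apply, smul_eq_mul] at h1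
    rw [hup i (by omega) y (by omega), raise_apply_of_ne (i := i + 1 + 2) v (by omega),
      aeval_pPoly_apply_of_ne hΓ hbip hv (by omega) (by omega)] at h1
    refine mul_right_cancel₀ hy0 ?_
    linear_combination h1
  -- Coefficient of w_i in A p_{i+3}(A) v = c_{i+4} p_{i+4}(A) v + b_{i+4} p_{i+2}(A) v; here
  -- p_{i+4}(A) v has no component in layer i + 2.
  · intro i hi
    obtain ⟨y, hy, hy0⟩ := hex i (by omega)
    have h1 := congrFun (A_mulVec_aeval_pPoly hΓ hbip (i := i + 2) (by omega) v) y
    rw [he (i + 1) (by omega), he (i + 2) (by omega), he i (by omega), Matrix.mulVec_add,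
      Matrix.mulVec_smul, hβ i (by omega)] at h1
    simp only [Pi.add_apply, Pi.smul_apply, smul_eq_mul] at h1
    rw [A_mulVec_apply_eq_zero (m := i + 1 + 2 + 2) hΓ.1 hbip
        (fun z hz => raise_apply_of_ne v hz) (by omega) (by omega),
      raise_apply_of_ne (i := i + 2) v (by omega),
      raise_apply_of_ne (i := i + 2 + 2) v (by omega)] at h1
    refine mul_right_cancel₀ hy0 ?_
    linear_combination h1

/-- The solution of the recurrences of `exists_raise_coefficients` in terms of polynomial
values `q_i`. -/
theorem recurrence_solution {D : ℕ} {b c e β q σ : ℕ → ℂ} {η : ℂ} (hη : 1 + η ≠ 0)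
    (hD : 4 ≤ D) (hb : ∀ i < D, b i ≠ 0) (hc : ∀ i, 1 ≤ i → i ≤ D → c i ≠ 0)
    (hc1 : c 1 = 1) (hβ0 : ∀ i, i + 3 ≤ D → β i ≠ 0) (he0 : e 0 = 1 + η)
    (hβ : β 0 = c 2 * e 0 + b 2)
    (h1 : ∀ i, i + 4 ≤ D → β (i + 1) + e i * c (i + 1) = c (i + 3) * e (i + 1) + b (i + 3))
    (h2 : ∀ i, i + 4 ≤ D → e (i + 1) * β i = b (i + 4) * e i)
    (hσ : ∀ i, σ (i + 2) = σ i) (hq0 : q 0 = 1) (hq1 : q 1 = 1) (hσ0 : σ 0 = 1)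
    (hσ1 : σ 1 = b 2 * (1 - b 3 / (1 + η)))
    (hq : ∀ i, i + 2 ≤ D → σ (i + 1) * q (i + 1) = c (i + 2) * q (i + 2) + b (i + 2) * q i) :
    ∀ i, i + 4 ≤ D → q i ≠ 0 ∧ q (i + 1) ≠ 0 ∧ q (i + 2) ≠ 0 ∧
      e i * q (i + 2) * c (i + 1) * c (i + 2) = -(b (i + 2) * b (i + 3) * q i) := by
  intro i
  induction i using Nat.strong_induction_on with
  | _ i ih =>
    intro hi
    cases i with
    | zero =>
      -- This is where the value ψ of `σ 1` enters: it is the one that matches e_0 = 1 + η.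
      have hq2 : (1 + η) * (c 2 * q 2) = -(b 2 * b 3) := by
        have := hq 0 (by omega)
        rw [zero_add, zero_add, hq1, hq0, hσ1] at this
        field_simp at this
        linear_combination -this
      refine ⟨by rw [hq0]; exact one_ne_zero, by rw [hq1]; exact one_ne_zero, ?_, ?_⟩
      · rw [zero_add]
        intro h0
        rw [h0, mul_zero, mul_zero] at hq2
        exact mul_ne_zero (hb 2 (by omega)) (hb 3 (by omega)) (neg_eq_zero.1 hq2.symm)
      · rw [he0, zero_add, zero_add, zero_add, hc1, hq0]
        linear_combination hq2
    | succ i =>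
      obtain ⟨n0, n1, n2, hei⟩ := ih i (by omega) (by omega)
      have hc1' := hc (i + 1) (by omega) (by omega)
      have hc2' := hc (i + 2) (by omega) (by omega)
      have hb2' := hb (i + 2) (by omega)
      -- Insert the known e's into `h1` (or into `hβ` when i = 0) and simplify by the recurrence of
      -- q. As β_i ≠ 0, this identity yields q_{i+3} ≠ 0, and with `h2` it yields e_{i+1}.
      have hβi : β i * (c (i + 1) * q (i + 1) * q (i + 2)) =
          b (i + 2) * c (i + 3) * q i * q (i + 3) := by
        have hq' := hq (i + 1) (by omega)
        cases i with
        | zero =>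
          rw [hσ, hσ0] at hq'
          simp only [zero_add, Nat.reduceAdd, hc1, hq0, hq1] at hei hq' ⊢
          rw [hβ]
          linear_combination hei + b 2 * hq'
        | succ j =>
          obtain ⟨m0, m1, m2, hej⟩ := ih j (by omega) (by omega)
          have hq'' := hq j (by omega)
          have h1' := h1 j (by omega)
          have hcj := hc (j + 1) (by omega) (by omega)
          rw [hσ] at hq'
          have ei : e (j + 1) = -(b (j + 3) * b (j + 4) * q (j + 1)) /
              (q (j + 3) * c (j + 2) * c (j + 3)) := by
            rw [eq_div_iff (mul_ne_zero (mul_ne_zero n2 hc1') hc2')]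
            linear_combination hei
          have ej : e j * c (j + 1) = -(b (j + 2) * b (j + 3) * q j) / (q (j + 2) * c (j + 2)) := by
            rw [eq_div_iff (mul_ne_zero m2 hc1')]
            linear_combination hej
          have hβj : β (j + 1) = c (j + 3) * e (j + 1) + b (j + 3) - e j * c (j + 1) := by
            linear_combination h1'
          rw [hβj, ei, ej]
          simp only [add_assoc, Nat.reduceAdd] at hq' hq'' hc1' hc2' n1 n2 m2 ⊢
          field_simp
          linear_combination q (j + 1) * hq' - q (j + 3) * hq''
      have n3 : q (i + 3) ≠ 0 := by
        intro h0
        rw [h0, mul_zero] at hβi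
        exact mul_ne_zero (hβ0 i (by omega)) (mul_ne_zero (mul_ne_zero hc1' n1) n2) hβi
      refine ⟨n1, n2, n3, ?_⟩
      have h2' := h2 i (by omega)
      have hne : b (i + 2) * q i ≠ 0 := mul_ne_zero hb2' n0
      refine mul_left_cancel₀ hne ?_
      simp only [add_assoc, Nat.reduceAdd]
      linear_combination (-e (i + 1) * c (i + 2)) * hβi +
        c (i + 1) * c (i + 2) * q (i + 1) * q (i + 2) * h2' +
        b (i + 4) * q (i + 1) * hei

end Recurrences

/-! ### The transition polynomials g_i -/

section TransitionPolynomials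

variable {X : Type*} [Fintype X] {Γ : SimpleGraph X}

theorem kk_mul_b_mul_b_ne_zero (hΓ : IsDistanceRegular Γ) (hbip : Γ.IsBipartite) {i : ℕ}
    (hi : i + 2 ≤ Γ.diam) : kk Γ i * b Γ i * b Γ (i + 1) ≠ 0 :=
  (mul_pos (mul_pos (kk_pos hΓ hbip (by omega)) (b_pos hΓ (by omega)))
    (b_pos hΓ (by omega))).ne'

theorem kk_mul_b_mul_b (hΓ : IsDistanceRegular Γ) (hbip : Γ.IsBipartite) {i : ℕ}
    (hi : i + 2 ≤ Γ.diam) :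
    kk Γ i * b Γ i * b Γ (i + 1) = kk Γ (i + 2) * c Γ (i + 1) * c Γ (i + 2) := by
  rw [kk_mul_b hΓ hbip (by omega), mul_right_comm, kk_mul_b hΓ hbip (by omega)]
  ring

theorem gPoly_of_lt (hΓ : IsDistanceRegular Γ) (hbip : Γ.IsBipartite) (hD : 3 ≤ Γ.diam) {ψ : ℝ}
    {i : ℕ} (hi : i < 2) (h0 : (PPoly Γ i).eval ψ ≠ 0) : gPoly Γ ψ i = pPoly Γ i := by
  have hK := kk_mul_b_mul_b_ne_zero hΓ hbip (i := i) (by omega)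
  have h1 : gPoly Γ ψ i = C ((PPoly Γ i).eval ψ / (PPoly Γ i).eval ψ *
      (kk Γ i * b Γ i * b Γ (i + 1) / (kk Γ i * b Γ i * b Γ (i + 1)))) * pPoly Γ i := by
    rw [gPoly]
    interval_cases i
    · exact sum_filter_even_zero _
    · exact sum_filter_even_one _
  rw [h1, div_self h0, div_self hK, one_mul, C_1, one_mul]

/-- The weights of p_h in g_{i+2} and g_i have a ratio independent of h, simplified by k_i b_i
b_{i+1} = k_{i+2} c_{i+1} c_{i+2}. -/
theorem gPoly_add_two (hΓ : IsDistanceRegular Γ) (hbip : Γ.IsBipartite) {ψ : ℝ}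
    {i : ℕ} (hi : i + 4 ≤ Γ.diam) (h0 : (PPoly Γ i).eval ψ ≠ 0)
    (h2 : (PPoly Γ (i + 2)).eval ψ ≠ 0) :
    gPoly Γ ψ (i + 2) = pPoly Γ (i + 2) +
      C ((PPoly Γ i).eval ψ * (b Γ (i + 2) * b Γ (i + 3)) /
        ((PPoly Γ (i + 2)).eval ψ * (c Γ (i + 1) * c Γ (i + 2)))) * gPoly Γ ψ i := by
  have hK := kk_mul_b_mul_b_ne_zero hΓ hbip (i := i) (by omega)
  have hK2 := kk_mul_b_mul_b_ne_zero hΓ hbip (i := i + 2) (by omega)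
  have hk := (kk_pos hΓ hbip (i := i + 2) (by omega)).ne'
  have hc1 := (c_pos hΓ (i := i + 1) (by omega) (by omega)).ne'
  have hc2 := (c_pos hΓ (i := i + 2) (by omega) (by omega)).ne'
  rw [gPoly, sum_filter_even_sub, div_self h2, div_self hK2, one_mul, C_1, one_mul, gPoly,
    Finset.mul_sum]
  congr 1
  refine Finset.sum_congr rfl fun h _ => ?_
  rw [← mul_assoc, ← C_mul, kk_mul_b_mul_b hΓ hbip (i := i) (by omega)]
  congr 2
  by_cases hh : kk Γ h * b Γ h * b Γ (h + 1) = 0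
  · rw [hh, div_zero, div_zero, mul_zero, mul_zero, mul_zero]
  · field_simp

/-- In λ p_{i+1}, the factor λ combines with that of an odd p_{i+1} to λ², which becomes ψ; for even
i + 1 it cancels against the odd terms on the right. -/
theorem PPoly_eval_succ (hΓ : IsDistanceRegular Γ) (hbip : Γ.IsBipartite) (ψ : ℝ) {i : ℕ}
    (hi : i + 2 ≤ Γ.diam) :
    (if Even (i + 1) then 1 else ψ) * (PPoly Γ (i + 1)).eval ψ =
      c Γ (i + 2) * (PPoly Γ (i + 2)).eval ψ + b Γ (i + 2) * (PPoly Γ i).eval ψ := by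
  by_cases he : Even i
  · have := congrArg (eval ψ) (PPoly_succ_of_even hΓ hbip hi he)
    simp only [eval_mul, eval_add, eval_X, eval_C] at this
    rw [if_neg (by grind), this]
  · have := congrArg (eval ψ) (PPoly_succ_of_odd hΓ hbip hi he)
    simp only [eval_mul, eval_add, eval_C] at this
    rw [if_pos (by grind), one_mul, this]

variable [DecidableEq X] {x : X} {W : Submodule ℂ (X → ℂ)}

/-- Here e_0 = 1 + η = 0, and e_{i+1} β_i = b_{i+4} e_i with β_i ≠ 0 propagates the zero. -/
theorem raise_eq_aeval_pPoly (hΓ : IsDistanceRegular Γ) (hbip : Γ.IsBipartite)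
    (hD : 4 ≤ Γ.diam) (hW : IsTModule Γ x W) (hthin : IsThin Γ x W)
    (hend : HasEndpoint Γ x W 2) {v : X → ℂ} (hv : IsLocalEigenvector Γ x (-1) v)
    (hvW : v ∈ W) (hne : ∀ i ≤ Γ.diam - 2, raise Γ x v i ≠ 0) {i : ℕ} (hi : i ≤ Γ.diam - 2) :
    raise Γ x v i = aeval (A Γ) (pPoly Γ i) *ᵥ v := by
  obtain ⟨e, β, he, hβ0, he0, -, -, h2⟩ :=
    exists_raise_coefficients hΓ hbip hD hW hthin hend hv hvW hne
  by_cases hi2 : i < 2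
  · rw [aeval_pPoly_mulVec_of_lt hΓ hbip hW hend hv hvW hi2]
  obtain ⟨i, rfl⟩ := Nat.exists_eq_add_of_le' (not_lt.1 hi2)
  have hzero : ∀ j, j + 4 ≤ Γ.diam → e j = 0 := by
    intro j
    induction j with
    | zero => intro _; rw [he0]; simp
    | succ j ih =>
      intro hj
      have := h2 j (by omega)
      rw [ih (by omega), mul_zero] at this
      exact (mul_eq_zero.1 this).resolve_right (hβ0 j (by omega))
  rw [he i (by omega), hzero i (by omega), zero_smul, add_zero]

/-- With e_i solved, w_{i+2} = p_{i+2}(A) v - e_i w_i is `gPoly_add_two` applied to v, and the two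
agree for i < 2. -/
theorem raise_eq_aeval_gPoly (hΓ : IsDistanceRegular Γ) (hbip : Γ.IsBipartite)
    (hD : 4 ≤ Γ.diam) (hW : IsTModule Γ x W) (hthin : IsThin Γ x W)
    (hend : HasEndpoint Γ x W 2) {η : ℝ} (hη : η ≠ -1) {v : X → ℂ}
    (hv : IsLocalEigenvector Γ x η v) (hvW : v ∈ W)
    (hne : ∀ i ≤ Γ.diam - 2, raise Γ x v i ≠ 0) :
    (∀ i ≤ Γ.diam - 2, (PPoly Γ i).eval (psi Γ η) ≠ 0) ∧
      ∀ i ≤ Γ.diam - 2, raise Γ x v i = aeval (A Γ) (gPoly Γ (psi Γ η) i) *ᵥ v := by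
  obtain ⟨e, β, he, hβ0, he0, hβ, h1, h2⟩ :=
    exists_raise_coefficients hΓ hbip hD hW hthin hend hv hvW hne
  have hη' : 1 + η ≠ 0 := fun h => hη (by linarith)
  have hsol := recurrence_solution (D := Γ.diam) (b := fun i => (b Γ i : ℂ))
    (c := fun i => (c Γ i : ℂ)) (e := e) (β := β)
    (q := fun i => (((PPoly Γ i).eval (psi Γ η) : ℝ) : ℂ))
    (σ := fun i => ((if Even i then 1 else psi Γ η : ℝ) : ℂ)) (η := η)
    (by exact_mod_cast hη') hD (fun i hi => by exact_mod_cast (b_pos hΓ hi).ne')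
    (fun i h1 hi => by exact_mod_cast (c_pos hΓ h1 hi).ne')
    (by rw [c_one hΓ (by omega), Complex.ofReal_one]) hβ0 he0 hβ h1 h2
    (fun i => by simp [Nat.even_add]) (by simp [PPoly_zero])
    (by simp [PPoly_one hΓ (show 1 ≤ Γ.diam by omega)]) (by simp)
    (by simp [psi]) (fun i hi => by exact_mod_cast PPoly_eval_succ hΓ hbip (psi Γ η) hi)
  have hq : ∀ i ≤ Γ.diam - 2, (PPoly Γ i).eval (psi Γ η) ≠ 0 := by
    intro i hi
    by_cases hi2 : i < 2
    · interval_cases i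
      · simp [PPoly_zero]
      · simp [PPoly_one hΓ (show 1 ≤ Γ.diam by omega)]
    · obtain ⟨i, rfl⟩ := Nat.exists_eq_add_of_le' (not_lt.1 hi2)
      exact fun h => (hsol i (by omega)).2.2.1 (by exact_mod_cast h)
  refine ⟨hq, fun i => ?_⟩
  induction i using Nat.strong_induction_on with
  | _ i ih =>
    intro hi
    by_cases hi2 : i < 2
    · rw [gPoly_of_lt hΓ hbip (by omega) hi2 (hq i hi),
        aeval_pPoly_mulVec_of_lt hΓ hbip hW hend hv hvW hi2]
    · obtain ⟨i, rfl⟩ := Nat.exists_eq_add_of_le' (not_lt.1 hi2)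
      have hq2 := hq (i + 2) hi
      have hc1 := (c_pos hΓ (i := i + 1) (by omega) (by omega)).ne'
      have hc2 := (c_pos hΓ (i := i + 2) (by omega) (by omega)).ne'
      have hei : e i = -(((PPoly Γ i).eval (psi Γ η) * (b Γ (i + 2) * b Γ (i + 3)) /
          ((PPoly Γ (i + 2)).eval (psi Γ η) * (c Γ (i + 1) * c Γ (i + 2))) : ℝ) : ℂ) := by
        have h3 := (hsol i (by omega)).2.2.2
        have hd : (((PPoly Γ (i + 2)).eval (psi Γ η) : ℝ) : ℂ) *
            ((c Γ (i + 1) : ℂ) * (c Γ (i + 2) : ℂ)) ≠ 0 := by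
          exact_mod_cast mul_ne_zero hq2 (mul_ne_zero hc1 hc2)
        push_cast
        rw [← neg_div, eq_div_iff hd]
        linear_combination h3
      rw [gPoly_add_two hΓ hbip (by omega) (hq i (by omega)) hq2, map_add, Matrix.add_mulVec,
        aeval_C_mul_mulVec, ← ih i (by omega) (by omega), he i (by omega), hei, neg_smul,
        neg_add_cancel_right]

end TransitionPolynomials

end BipartiteDRG

theorem mainTheorem8 {X : Type*} [Fintype X] [DecidableEq X] (Γ : SimpleGraph X)
    (hΓ : IsDistanceRegular Γ) (hbip : Γ.IsBipartite) (D : ℕ) (hD : Γ.diam = D) (hD4 : 4 ≤ D)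
    (hk : 3 ≤ b Γ 0) (x : X) (W : Submodule ℂ (X → ℂ))
    (hW : IsIrreducibleTModule Γ x W) (hthin : IsThin Γ x W) (hend : HasEndpoint Γ x W 2)
    (η : ℝ) (hη : HasLocalEigenvalue Γ x W η)
    (hη1 : tilde Γ (theta Γ 1) < η) (hηd : η < tilde Γ (theta Γ (D / 2)))
    (v : X → ℂ) (hv : v ∈ EstarSpace Γ x 2 W) (hv0 : v ≠ 0) :
    IsBasisOf W (fun j : Fin (D - 1) => E Γ (j + 1) *ᵥ v) ∧
    IsBasisOf W (fun i : Fin (D - 1) => (Estar Γ x (i + 2) * distMatrix Γ i) *ᵥ v) ∧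
    (η ≠ -1 →
      (∀ i ≤ D - 2, (PPoly Γ i).eval (psi Γ η) ≠ 0) ∧
      ∀ i ≤ D - 2, (Estar Γ x (i + 2) * distMatrix Γ i) *ᵥ v =
        ∑ j ∈ Finset.Icc 1 (D - 1),
          (((gPoly Γ (psi Γ η) i).eval (theta Γ j) : ℝ) : ℂ) • (E Γ j *ᵥ v)) ∧
    (η = -1 →
      ∀ i ≤ D - 2, (Estar Γ x (i + 2) * distMatrix Γ i) *ᵥ v =
        ∑ j ∈ Finset.Icc 1 (D - 1),
          (((pPoly Γ i).eval (theta Γ j) : ℝ) : ℂ) • (E Γ j *ᵥ v)) := by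
  subst hD
  have hT := hW.1
  have hvW : v ∈ W := by
    obtain ⟨w, hw, rfl⟩ := mem_EstarSpace.1 hv
    exact hT.Estar_mulVec_mem 2 hw
  have hloc := isLocalEigenvector hΓ hbip hT hend hη hv
  have hE : ∀ j, 1 ≤ j → j ≤ Γ.diam - 1 → E Γ j *ᵥ v ≠ 0 := fun j h1 hj =>
    hloc.E_mulVec_ne_zero hΓ hbip hD4 hv0 hη1.ne hηd.ne' h1 hj
  have hne : ∀ i ≤ Γ.diam - 2, raise Γ x v i ≠ 0 := fun i hi =>
    (exists_raise_eq_aeval hΓ hbip hD4 hT hthin hend hloc hvW hE hi).1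
  have hbasis := isBasisOf_raise hΓ hbip hD4 hT hthin hend hvW hne
  refine ⟨isBasisOf_E hΓ hbip hD4 hT hvW hE hbasis, hbasis, fun h => ?_, fun h i hi => ?_⟩
  · obtain ⟨h1, h2⟩ := raise_eq_aeval_gPoly hΓ hbip hD4 hT hthin hend h hloc hvW hne
    exact ⟨h1, fun i hi => (h2 i hi).trans (hloc.aeval_mulVec hΓ hbip hD4 _)⟩
  · subst h
    exact (raise_eq_aeval_pPoly hΓ hbip hD4 hT hthin hend hloc hvW hne hi).trans
      (hloc.aeval_mulVec hΓ hbip hD4 _)
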